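/- **Model.** Let $0=p_0$, let $p_1,\dots,p_\ell>0$ be distinct prices, $q_1,\dots,q_k>0$ distinct sizes, and $\theta_{ij}\ge 0$ ($0\le i\le \ell$, $1\le j\le k$) with $\sum_{i,j}\theta_{ij}=1$. Let $(P_t,Q_t)$, $t=1,2,\dots$, be i.i.d. with $\mathsf P[P_t=p_i,\,Q_t=q_j]=\theta_{ij}$; $P_t=0$ means that no request arrives in period $t$. In a problem with last period $N$ the value function is given by $$V_N(N,d)=\sum_{i\ne0}\sum_{j:\,q_j\le d}\theta_{ij}p_iq_j,$$ $$V_N(t,d)=V_N(t+1,d)\Big[\sum_j\theta_{0j}+\sum_{i\neq0}\sum_{j:\,q_j>d}\theta_{ij}\Big]+\sum_{i\ne0}\sum_{j:\,q_j\le d}\theta_{ij}\max\{p_iq_j+V_N(t+1,d-q_j),\,V_N(t+1,d)\}$$ for $1\le t<N$. The optimal policy, with $d$ units available in period $s$, accepts a request $(P_s,Q_s)$ with $P_s\neq 0$ if and only if $Q_s\le d$ and either $s=N$ or $P_sQ_s+V_N(s+1,d-Q_s)\ge V_N(s+1,d)$; an accepted request earns $P_sQ_s$ and uses up $Q_s$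 units. Let $X^N_{t,d}(s)$ be the reward collected by this policy in the periods $t,\dots,s$ when it starts in period $t$ with $d$ units (no request arrives in period $0$). Fix an integer $T\ge1$ and put, for $t\in[0,T]$ and $d\ge0$, $$V^n(t,d)=\tfrac1n X^{nT}_{\lfloor nt\rfloor,\lfloor nd\rfloor}(nT),\qquad g(x)=\mathsf E\big[Q_1(P_1-x)^+\big],\qquad U=(0,T)\times(0,\infty).$$ **Theorem.** There is a (deterministic) function $u$ on $[0,T]\times[0,\infty)$ such that, almost surely, $V^n\to u$ as $n\to\infty$ uniformly on every compact subset of $[0,T]\times[0,\infty)$. The function $u$ is Lipschitz continuous and solves the boundary value problem $$u_x+g(u_y)=0 \ \text{ in } U,\qquad u(T,y)=h(y)\ (y\ge 0),\qquad u(x,0)=0\ (0\le x\le T),$$ where $h(y)=\lim_{n}\frac1n V_{nT}(nT,\lfloor ny\rfloor)=0$, and $u$ satisfies in $U$ the homogeneous Monge–Ampère equation $u_{xx}u_{yy}-u_{xy}^2=0$. The equations hold in the following senses. 1. The set $D$ of the points of $U$ at which $u$ is differentiable is open, $U\setminus D$ has Lebesgue measure zero, $u$ is $C^\infty$ on $D$,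 and both equations hold classically at every point of $D$. 2. On all of $U$ the equation $u_x+g(u_y)=0$ holds in the sense of distributions: $u$ has a locally integrable weak derivative $w=u_y$ such that $g(w)$ is locally integrable and $\int_U u\,\varphi_x=\int_U g(w)\,\varphi$ for all $\varphi\in C_c^\infty(U)$. 3. On all of $U$ the Monge–Ampère equation holds in the sense of Alexandrov: $u$ is concave on $U$, and the set of all $(a,b)\in\mathbb R^2$ for which some $z\in U$ satisfies $u(z')\le u(z)+a(z'_1-z_1)+b(z'_2-z_2)$ for all $z'\in U$ has Lebesgue measure zero. -/

import Mathlib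

open MeasureTheory ProbabilityTheory Filter Topology Set

noncomputable section

/-- The joint law of a request `(price, size)`: price `price i` and size `size j` occur together
with probability `prob i j`; the price `price 0 = 0` encodes that no request arrives. -/
structure RequestLaw (ℓ k : ℕ) where
  price : Fin (ℓ + 1) → ℝ
  size : Fin k → ℝ
  prob : Fin (ℓ + 1) → Fin k → ℝ
  price_zero : price 0 = 0
  price_pos : ∀ i, i ≠ 0 → 0 < price i
  price_injective : Function.Injective price
  size_pos : ∀ j, 0 < size j
  size_injective : Function.Injective size
  prob_nonneg : ∀ i j, 0 ≤ prob i j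
  prob_sum : ∑ i, ∑ j, prob i j = 1

/-- The requests `(P t, Q t)`, `t = 1, 2, …`, are independent with common law `L`.
Nothing is required of the index `t = 0`, where no request arrives. -/
structure IsRequestSequence {Ω : Type*} [MeasurableSpace Ω] {ℓ k : ℕ} (L : RequestLaw ℓ k)
    (μ : Measure Ω) (P Q : ℕ → Ω → ℝ) : Prop where
  measurable_price : ∀ t, 1 ≤ t → Measurable (P t)
  measurable_size : ∀ t, 1 ≤ t → Measurable (Q t)
  law : ∀ t, 1 ≤ t → ∀ i j,
    μ {ω | P t ω = L.price i ∧ Q t ω = L.size j} = ENNReal.ofReal (L.prob i j)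
  indep : iIndepFun (fun (t : ℕ) (ω : Ω) => (P (t + 1) ω, Q (t + 1) ω)) μ

namespace RequestLaw

variable {ℓ k : ℕ}

/-- The probability that no request arrives. -/
def noArrival (L : RequestLaw ℓ k) : ℝ := ∑ j, L.prob 0 j

/-- The probability that a request arrives whose size exceeds `d`. -/
def tooLarge (L : RequestLaw ℓ k) (d : ℝ) : ℝ :=
  ∑ i with i ≠ 0, ∑ j with d < L.size j, L.prob i j

/-- The dynamic programming value with `d` units available when `r` further periods follow the
current one. -/
def valueToGo (L : RequestLaw ℓ k) : ℕ → ℝ → ℝ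
  | 0, d => ∑ i with i ≠ 0, ∑ j with L.size j ≤ d, L.prob i j * (L.price i * L.size j)
  | r + 1, d =>
      valueToGo L r d * (L.noArrival + L.tooLarge d) +
        ∑ i with i ≠ 0, ∑ j with L.size j ≤ d, L.prob i j *
          max (L.price i * L.size j + valueToGo L r (d - L.size j)) (valueToGo L r d)

/-- The value function `V(t, d)` of the problem with last period `N`. The first request arrives
in period `1`, so that `V(0, d) = V(1, d)`. -/
def value (L : RequestLaw ℓ k) (N t : ℕ) (d : ℝ) : ℝ := L.valueToGo (N - max t 1) d

/-- The optimal decision in period `s`, with last period `N` and `d` units available: a request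
with price `p` and size `q` is accepted iff there is a request, it fits, and accepting it is at
least as good as rejecting it (in the last period every request that fits is accepted). -/
def Accepts (L : RequestLaw ℓ k) (N s : ℕ) (d p q : ℝ) : Prop :=
  1 ≤ s ∧ p ≠ 0 ∧ q ≤ d ∧
    (s = N ∨ L.value N (s + 1) d ≤ p * q + L.value N (s + 1) (d - q))

open Classical in
/-- The pair (units still available, reward collected) after the periods `t, …, t + m - 1`, for
the optimal policy started in period `t` with `d` units, along the realized prices `P` and
sizes `Q`. -/
def run (L : RequestLaw ℓ k) (N : ℕ) (P Q : ℕ → ℝ) (t : ℕ) (d : ℝ) : ℕ → ℝ × ℝ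
  | 0 => (d, 0)
  | m + 1 =>
      let z := run L N P Q t d m
      if L.Accepts N (t + m) z.1 (P (t + m)) (Q (t + m)) then
        (z.1 - Q (t + m), z.2 + P (t + m) * Q (t + m))
      else z

/-- `X_{t,d}(s)`: the reward collected in the periods `t, …, s` by the optimal policy started in
period `t` with `d` units available, the last period of the problem being `N`. -/
def reward (L : RequestLaw ℓ k) (N : ℕ) (P Q : ℕ → ℝ) (t : ℕ) (d : ℝ) (s : ℕ) : ℝ :=
  (L.run N P Q t d (s + 1 - t)).2

/-- `V^n(t, d) = X_{⌊nt⌋,⌊nd⌋}(nT) / n` at `z = (t, d)`, the problem having last period `nT`. -/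
def scaledReward (L : RequestLaw ℓ k) (T : ℕ) (P Q : ℕ → ℝ) (n : ℕ) (z : ℝ × ℝ) : ℝ :=
  L.reward (n * T) P Q ⌊(n : ℝ) * z.1⌋₊ (⌊(n : ℝ) * z.2⌋₊ : ℝ) (n * T) / n

end RequestLaw

/-- `x ↦ E[Q (P - x)⁺]`. -/
def lossFunction {Ω : Type*} [MeasurableSpace Ω] (μ : Measure Ω) (P Q : Ω → ℝ) (x : ℝ) : ℝ :=
  ∫ ω, Q ω * max (P ω - x) 0 ∂μ

/-- The partial derivative in the first variable. -/
def partialX (u : ℝ × ℝ → ℝ) (z : ℝ × ℝ) : ℝ := deriv (fun x => u (x, z.2)) z.1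

/-- The partial derivative in the second variable. -/
def partialY (u : ℝ × ℝ → ℝ) (z : ℝ × ℝ) : ℝ := deriv (fun y => u (z.1, y)) z.2

/-- Test functions on the open set `U`. -/
def IsTestFunction (U : Set (ℝ × ℝ)) (φ : ℝ × ℝ → ℝ) : Prop :=
  ContDiff ℝ (⊤ : ℕ∞) φ ∧ HasCompactSupport φ ∧ tsupport φ ⊆ U

/-- `u_x + g(u_y) = 0` on the open set `U` in the sense of distributions: `u` has a locally
integrable weak derivative `w = u_y` and the distribution `u_x` is `-g(w)`. -/
def IsDistributionalSolution (U : Set (ℝ × ℝ)) (g : ℝ → ℝ) (u : ℝ × ℝ → ℝ) : Prop :=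
  LocallyIntegrableOn u U ∧
  ∃ w : ℝ × ℝ → ℝ, LocallyIntegrableOn w U ∧ LocallyIntegrableOn (fun z => g (w z)) U ∧
    ∀ φ, IsTestFunction U φ →
      (∫ z in U, u z * partialY φ z = - ∫ z in U, w z * φ z) ∧
      (∫ z in U, u z * partialX φ z = ∫ z in U, g (w z) * φ z)

/-- The superdifferential at `z` of `u`, a function on `U`. -/
def superdifferential (U : Set (ℝ × ℝ)) (u : ℝ × ℝ → ℝ) (z : ℝ × ℝ) : Set (ℝ × ℝ) :=
  {a | ∀ z' ∈ U, u z' ≤ u z + a.1 * (z'.1 - z.1) + a.2 * (z'.2 - z.2)}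

/-- `u_xx u_yy - u_xy² = 0` in the sense of Alexandrov, for a concave function `u` on the open
convex set `U`: the Monge–Ampère measure of `U` is zero. -/
def IsAlexandrovSolution (U : Set (ℝ × ℝ)) (u : ℝ × ℝ → ℝ) : Prop :=
  ConcaveOn ℝ U u ∧ volume (⋃ z ∈ U, superdifferential U u z) = 0

/-- The points of `U` at which `u` is differentiable. -/
def differentiabilitySet (U : Set (ℝ × ℝ)) (u : ℝ × ℝ → ℝ) : Set (ℝ × ℝ) :=
  {z ∈ U | DifferentiableAt ℝ u z}

end

/-! Let x ≥ 0 be a price per unit of stock. A request (p, q) gains at most q(p - x)⁺ beyond the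
worth of the stock it uses, so r periods and d units yield in expectation at most xd + r g(x). As g
is affine between neighbouring prices, minimising this over x from 0 to the top price amounts to a
minimum over the finitely many prices: the value `fluid` (`optimalValue_le_fluid`, `fluid_le`).

Conversely, `fluid` nearly satisfies the dynamic programming inequality. The obstacle is its kinks,
where one request can make the minimising x jump. Adding κx² to the minimised cost makes the minimum
grow quadratically, and each period then costs only O(1/κ) (`exists_regularized_le_optimalValue`).
Over O(n) periods the choice κ = √n gives a total error O(√n).

The realised reward concentrates: reward so far plus optimal value of the remaining stock is a
martingale with bounded increments, because the policy attains the maximum in the dynamic programme.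
Exponential tail bounds beat the polynomial number of starting states, and Borel–Cantelli gives
almost sure uniform convergence (`ae_eventually_deviation_lt`).

The limit is u(x, y) = minᵢ (pᵢ y + (T - x) g(pᵢ)). Each piece has gradient (-g(pᵢ), pᵢ) and so
solves both equations; at a point of differentiability only one piece is active nearby. Lipschitz
continuity turns the almost everywhere equation into the distributional one. Finally u is concave
and homogeneous about (T, 0), which forces all supergradients onto the frontier of one convex set, a
null set. -/

noncomputable section

/-! ### The fluid value and its comparison with the dynamic programme. -/

namespace RequestLaw

variable {ℓ k : ℕ}

/-- `x ↦ E[Q (P - x)⁺]` for a request `(P, Q)` with law `L`. -/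
def loss (L : RequestLaw ℓ k) (x : ℝ) : ℝ :=
  ∑ i, ∑ j, L.prob i j * (L.size j * max (L.price i - x) 0)

/-- The largest price. -/
def topPrice (L : RequestLaw ℓ k) : ℝ := Finset.univ.sup' ⟨0, Finset.mem_univ _⟩ L.price

/-- The sum of all sizes, a bound for each of them. -/
def totalSize (L : RequestLaw ℓ k) : ℝ := ∑ j, L.size j

/-- The optimal revenue of the fluid problem with `s` units of time and `y` units of stock. -/
def fluid (L : RequestLaw ℓ k) (s y : ℝ) : ℝ :=
  Finset.univ.inf' ⟨0, Finset.mem_univ _⟩ fun i => L.price i * y + s * L.loss (L.price i)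

/-- The value of a request with price `price i` and size `size j` when `d` units are available
and `v` is the value of the remaining stock. -/
def payoff (L : RequestLaw ℓ k) (v : ℝ → ℝ) (d : ℝ) (i : Fin (ℓ + 1)) (j : Fin k) : ℝ :=
  if i ≠ 0 ∧ L.size j ≤ d then max (L.price i * L.size j + v (d - L.size j)) (v d) else v d

/-- The value of the dynamic programme with `d` units available and `r` periods to go. -/
def optimalValue (L : RequestLaw ℓ k) : ℕ → ℝ → ℝ
  | 0, _ => 0
  | r + 1, d => ∑ i, ∑ j, L.prob i j * L.payoff (optimalValue L r) d i j

variable (L : RequestLaw ℓ k)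

theorem price_nonneg (i : Fin (ℓ + 1)) : 0 ≤ L.price i := by
  by_cases h : i = 0
  · rw [h, L.price_zero]
  · exact (L.price_pos i h).le

theorem price_eq_zero_iff {i : Fin (ℓ + 1)} : L.price i = 0 ↔ i = 0 :=
  ⟨fun h => by_contra fun hi => (L.price_pos i hi).ne' h, fun h => h ▸ L.price_zero⟩

theorem price_le_topPrice (i : Fin (ℓ + 1)) : L.price i ≤ L.topPrice :=
  Finset.le_sup' _ (Finset.mem_univ i)

theorem topPrice_nonneg : 0 ≤ L.topPrice := (L.price_nonneg 0).trans (L.price_le_topPrice 0)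

theorem exists_price_eq_topPrice : ∃ i, L.price i = L.topPrice := by
  obtain ⟨i, -, hi⟩ := Finset.exists_mem_eq_sup' ⟨0, Finset.mem_univ _⟩ L.price
  exact ⟨i, hi.symm⟩

theorem size_le_totalSize (j : Fin k) : L.size j ≤ L.totalSize :=
  Finset.single_le_sum (fun j _ => (L.size_pos j).le) (Finset.mem_univ j)

theorem totalSize_nonneg : 0 ≤ L.totalSize := Finset.sum_nonneg fun j _ => (L.size_pos j).le

theorem average_const (c : ℝ) : ∑ i, ∑ j, L.prob i j * c = c := by
  simp_rw [← Finset.sum_mul]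
  rw [L.prob_sum, one_mul]

theorem average_mono {f f' : Fin (ℓ + 1) → Fin k → ℝ} (h : ∀ i j, f i j ≤ f' i j) :
    ∑ i, ∑ j, L.prob i j * f i j ≤ ∑ i, ∑ j, L.prob i j * f' i j :=
  Finset.sum_le_sum fun i _ => Finset.sum_le_sum fun j _ =>
    mul_le_mul_of_nonneg_left (h i j) (L.prob_nonneg i j)

theorem average_const_add (c : ℝ) (f : Fin (ℓ + 1) → Fin k → ℝ) :
    ∑ i, ∑ j, L.prob i j * (c + f i j) = c + ∑ i, ∑ j, L.prob i j * f i j := by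
  simp_rw [mul_add, Finset.sum_add_distrib, L.average_const c]

theorem loss_nonneg (x : ℝ) : 0 ≤ L.loss x :=
  Finset.sum_nonneg fun i _ => Finset.sum_nonneg fun j _ =>
    mul_nonneg (L.prob_nonneg i j) (mul_nonneg (L.size_pos j).le (le_max_right _ _))

theorem loss_topPrice : L.loss L.topPrice = 0 :=
  Finset.sum_eq_zero fun i _ => Finset.sum_eq_zero fun j _ => by
    rw [max_eq_right (sub_nonpos.2 (L.price_le_topPrice i))]; simp

theorem continuous_loss : Continuous L.loss := by
  unfold loss
  fun_prop

/-- The only form of convexity needed for the quadratic growth in `exists_regularized_min`. -/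
theorem loss_midpoint_le (a b : ℝ) : L.loss ((a + b) / 2) ≤ (L.loss a + L.loss b) / 2 := by
  have h : (L.loss a + L.loss b) / 2 = ∑ i, ∑ j, L.prob i j *
      (L.size j * ((max (L.price i - a) 0 + max (L.price i - b) 0) / 2)) := by
    unfold loss
    simp_rw [← Finset.sum_add_distrib, Finset.sum_div]
    exact Finset.sum_congr rfl fun i _ => Finset.sum_congr rfl fun j _ => by ring
  rw [h]
  refine L.average_mono fun i j => mul_le_mul_of_nonneg_left ?_ (L.size_pos j).le
  refine max_le ?_ (by positivity)
  linarith [le_max_left (L.price i - a) 0, le_max_left (L.price i - b) 0]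

/-- `loss` is affine on every interval free of prices. -/
theorem loss_eq_of_convexCombination {a b s : ℝ} (hab : a ≤ b) (hs : s ∈ Icc (0 : ℝ) 1)
    (h : ∀ i, L.price i ≤ a ∨ b ≤ L.price i) :
    L.loss ((1 - s) * a + s * b) = (1 - s) * L.loss a + s * L.loss b := by
  obtain ⟨h0, h1⟩ := hs
  unfold loss
  simp_rw [Finset.mul_sum, ← Finset.sum_add_distrib]
  refine Finset.sum_congr rfl fun i _ => Finset.sum_congr rfl fun j _ => ?_
  have ha : 0 ≤ s * (b - a) := mul_nonneg h0 (sub_nonneg.2 hab)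
  have hb : 0 ≤ (1 - s) * (b - a) := mul_nonneg (sub_nonneg.2 h1) (sub_nonneg.2 hab)
  rcases h i with h | h
  · rw [max_eq_right (by linarith), max_eq_right (by linarith), max_eq_right (by linarith)]
    ring
  · rw [max_eq_left (by linarith), max_eq_left (by linarith), max_eq_left (by linarith)]
    ring

theorem fluid_le_price (s y : ℝ) (i : Fin (ℓ + 1)) :
    L.fluid s y ≤ L.price i * y + s * L.loss (L.price i) :=
  Finset.inf'_le _ (Finset.mem_univ i)

theorem exists_fluid_eq (s y : ℝ) :
    ∃ i, L.fluid s y = L.price i * y + s * L.loss (L.price i) := by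
  obtain ⟨i, -, hi⟩ := Finset.exists_mem_eq_inf' ⟨0, Finset.mem_univ _⟩
    fun i => L.price i * y + s * L.loss (L.price i)
  exact ⟨i, hi⟩

/-- The minimum over the prices in `fluid` is a minimum over all of `[0, topPrice]`. -/
theorem fluid_le (s y : ℝ) {x : ℝ} (hx : x ∈ Icc 0 L.topPrice) :
    L.fluid s y ≤ x * y + s * L.loss x := by
  obtain ⟨m, hm⟩ := L.exists_price_eq_topPrice
  -- The neighbouring prices below and above x: the cost is affine between them, so its value at x
  -- is a convex combination of two values at prices.
  obtain ⟨a, ha, hamax⟩ := Finset.exists_max_image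
    (Finset.univ.filter fun i => L.price i ≤ x) L.price
    ⟨0, by simpa [L.price_zero] using hx.1⟩
  obtain ⟨b, hb, hbmin⟩ := Finset.exists_min_image
    (Finset.univ.filter fun i => x ≤ L.price i) L.price
    ⟨m, by simpa [hm] using hx.2⟩
  simp only [Finset.mem_filter, Finset.mem_univ, true_and] at ha hb hamax hbmin
  have hsep : ∀ i, L.price i ≤ L.price a ∨ L.price b ≤ L.price i := fun i =>
    (le_total (L.price i) x).imp (hamax i) (hbmin i)
  obtain ⟨c, hc, rfl⟩ : ∃ c ∈ Icc (0 : ℝ) 1, (1 - c) * L.price a + c * L.price b = x := by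
    rcases (ha.trans hb).eq_or_lt with h | h
    · exact ⟨0, by simp, by linarith⟩
    · have h' := sub_pos.2 h
      refine ⟨(x - L.price a) / (L.price b - L.price a),
        ⟨by apply div_nonneg <;> linarith, by rw [div_le_one h']; linarith⟩, ?_⟩
      field_simp
      ring
  rw [L.loss_eq_of_convexCombination (ha.trans hb) hc hsep]
  have h1 := mul_le_mul_of_nonneg_left (L.fluid_le_price s y a) (sub_nonneg.2 hc.2)
  have h2 := mul_le_mul_of_nonneg_left (L.fluid_le_price s y b) hc.1
  linarith

theorem le_payoff (v : ℝ → ℝ) (d : ℝ) (i : Fin (ℓ + 1)) (j : Fin k) :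
    v d ≤ L.payoff v d i j := by
  unfold payoff
  split_ifs
  · exact le_max_right _ _
  · exact le_rfl

theorem payoff_le {v : ℝ → ℝ} (hv : Monotone v) (d : ℝ) (i : Fin (ℓ + 1)) (j : Fin k) :
    L.payoff v d i j ≤ v d + L.topPrice * L.totalSize := by
  have h : L.price i * L.size j ≤ L.topPrice * L.totalSize :=
    mul_le_mul (L.price_le_topPrice i) (L.size_le_totalSize j) (L.size_pos j).le L.topPrice_nonneg
  have h0 : 0 ≤ L.topPrice * L.totalSize := mul_nonneg L.topPrice_nonneg L.totalSize_nonneg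
  unfold payoff
  split_ifs
  · refine max_le ?_ (by linarith)
    have := hv (sub_le_self d (L.size_pos j).le)
    linarith
  · linarith

theorem monotone_payoff {v : ℝ → ℝ} (hv : Monotone v) (i : Fin (ℓ + 1)) (j : Fin k) :
    Monotone fun d => L.payoff v d i j := by
  intro d d' h
  by_cases hd : i ≠ 0 ∧ L.size j ≤ d
  · have hd' : i ≠ 0 ∧ L.size j ≤ d' := ⟨hd.1, hd.2.trans h⟩
    simp only [payoff, if_pos hd, if_pos hd']
    exact max_le_max (by linarith [hv (sub_le_sub_right h (L.size j))]) (hv h)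
  · refine le_trans (le_of_eq ?_) ((hv h).trans (L.le_payoff v d' i j))
    simp only [payoff, if_neg hd]

theorem monotone_optimalValue (r : ℕ) : Monotone (L.optimalValue r) := by
  induction r with
  | zero => exact fun _ _ _ => le_rfl
  | succ r ih => exact fun d d' h => L.average_mono fun i j => L.monotone_payoff ih i j h

theorem optimalValue_nonneg (r : ℕ) (d : ℝ) : 0 ≤ L.optimalValue r d := by
  induction r with
  | zero => exact le_rfl
  | succ r ih =>
    exact Finset.sum_nonneg fun i _ => Finset.sum_nonneg fun j _ =>
      mul_nonneg (L.prob_nonneg i j) (ih.trans (L.le_payoff _ d i j))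

/-- Starting from the value 0 after the last period, instead of from the last period itself, makes
the terminal formula an instance of the recursion. -/
theorem valueToGo_eq_optimalValue (r : ℕ) : L.valueToGo r = L.optimalValue (r + 1) := by
  have key : ∀ (v : ℝ → ℝ) (d : ℝ), ∑ i, ∑ j, L.prob i j * L.payoff v d i j =
      v d * (L.noArrival + L.tooLarge d) +
        ∑ i with i ≠ 0, ∑ j with L.size j ≤ d, L.prob i j *
          max (L.price i * L.size j + v (d - L.size j)) (v d) := by
    intro v d
    have h0 : ∑ i with ¬ i ≠ (0 : Fin (ℓ + 1)), ∑ j, L.prob i j * L.payoff v d i j =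
        v d * L.noArrival := by
      have : (Finset.univ.filter fun i : Fin (ℓ + 1) => ¬ i ≠ 0) = {0} := by ext; simp
      rw [this, Finset.sum_singleton, noArrival, Finset.mul_sum]
      exact Finset.sum_congr rfl fun j _ => by simp [payoff, mul_comm]
    rw [← Finset.sum_filter_add_sum_filter_not Finset.univ (fun i : Fin (ℓ + 1) => i ≠ 0), h0,
      mul_add, add_comm, add_assoc, tooLarge, Finset.mul_sum, ← Finset.sum_add_distrib]
    congr 1
    refine Finset.sum_congr rfl fun i hi => ?_
    have hi : i ≠ 0 := (Finset.mem_filter.1 hi).2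
    rw [← Finset.sum_filter_add_sum_filter_not Finset.univ (fun j => L.size j ≤ d), add_comm,
      Finset.mul_sum]
    simp_rw [not_le]
    congr 1 <;> refine Finset.sum_congr rfl fun j hj => ?_
    · simp [payoff, not_le.2 (Finset.mem_filter.1 hj).2, mul_comm]
    · simp [payoff, (Finset.mem_filter.1 hj).2, hi]
  induction r with
  | zero =>
    ext d
    rw [optimalValue, key, valueToGo]
    simp only [optimalValue, zero_mul, zero_add, add_zero]
    refine Finset.sum_congr rfl fun i _ => Finset.sum_congr rfl fun j _ => ?_
    rw [max_eq_left (mul_nonneg (L.price_nonneg i) (L.size_pos j).le)]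
  | succ r ih =>
    ext d
    rw [optimalValue, key, valueToGo, ih]

/-- Weak duality: accepting a request loses stock worth x times its size and earns its revenue, a
net gain of at most size times (price - x)⁺, whose mean is `loss x` per period. -/
theorem optimalValue_le (r : ℕ) {x d : ℝ} (hx : 0 ≤ x) (hd : 0 ≤ d) :
    L.optimalValue r d ≤ x * d + r * L.loss x := by
  induction r generalizing d with
  | zero => simpa [optimalValue] using mul_nonneg hx hd
  | succ r ih =>
    have h : x * d + ((r + 1 : ℕ) : ℝ) * L.loss x = ∑ i, ∑ j, L.prob i j *
        ((x * d + r * L.loss x) + L.size j * max (L.price i - x) 0) := by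
      rw [L.average_const_add, ← loss]
      push_cast
      ring
    rw [h]
    refine L.average_mono fun i j => ?_
    have h1 := mul_le_mul_of_nonneg_left (le_max_left (L.price i - x) 0) (L.size_pos j).le
    have h2 := mul_le_mul_of_nonneg_left (le_max_right (L.price i - x) 0) (L.size_pos j).le
    unfold payoff
    split_ifs with hij
    · refine max_le ?_ ?_
      · linarith [ih (sub_nonneg.2 hij.2)]
      · linarith [ih hd]
    · linarith [ih hd]

theorem optimalValue_le_fluid (r : ℕ) {d : ℝ} (hd : 0 ≤ d) :
    L.optimalValue r d ≤ L.fluid r d := by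
  obtain ⟨i, hi⟩ := L.exists_fluid_eq r d
  rw [hi]
  exact L.optimalValue_le r (L.price_nonneg i) hd

/-- A minimum of the fluid costs, regularized by `κ x²`, grows quadratically. -/
theorem exists_regularized_min (r : ℕ) (d κ : ℝ) :
    ∃ x ∈ Icc 0 L.topPrice, ∀ x' ∈ Icc 0 L.topPrice,
      x * d + r * L.loss x + κ * x ^ 2 + κ / 2 * (x' - x) ^ 2 ≤
        x' * d + r * L.loss x' + κ * x' ^ 2 := by
  obtain ⟨x, hx, hmin⟩ := (isCompact_Icc (a := (0 : ℝ)) (b := L.topPrice)).exists_isMinOn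
    ⟨0, left_mem_Icc.2 L.topPrice_nonneg⟩
    (f := fun x => x * d + r * L.loss x + κ * x ^ 2)
    (by have := L.continuous_loss; fun_prop)
  refine ⟨x, hx, fun x' hx' => ?_⟩
  -- Comparison with the midpoint: κx² contributes a convexity gap κ(x' - x)²/4, and doubling yields
  -- the constant κ/2.
  have h : x * d + r * L.loss x + κ * x ^ 2 ≤
      (x + x') / 2 * d + r * L.loss ((x + x') / 2) + κ * ((x + x') / 2) ^ 2 :=
    hmin (show (x + x') / 2 ∈ Icc 0 L.topPrice from
      ⟨by linarith [hx.1, hx'.1], by linarith [hx.2, hx'.2]⟩)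
  have h' := mul_le_mul_of_nonneg_left (L.loss_midpoint_le x x') (Nat.cast_nonneg (α := ℝ) r)
  nlinarith

/-- The regularized fluid value, shifted by the total size, is a subsolution of the dynamic
programming equation up to an error of order `1 / κ` in each period. -/
theorem exists_regularized_le_optimalValue {κ : ℝ} (hκ : 0 < κ) (r : ℕ) {d : ℝ} (hd : 0 ≤ d) :
    ∃ x ∈ Icc 0 L.topPrice, x * (d - L.totalSize) + r * L.loss x + κ * x ^ 2 ≤
      L.optimalValue r d + κ * L.topPrice ^ 2 + r * (L.totalSize ^ 2 / (2 * κ)) := by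
  have hS := L.totalSize_nonneg
  have hp := L.topPrice_nonneg
  have he : 0 ≤ L.totalSize ^ 2 / (2 * κ) := by positivity
  induction r generalizing d with
  | zero => exact ⟨0, left_mem_Icc.2 hp, by simp [optimalValue]; positivity⟩
  | succ r ih =>
    -- When some size might not fit, the top price makes the claim trivial: its loss is 0 and the
    -- shifted stock is negative. This is the purpose of the shift.
    rcases lt_or_ge d L.totalSize with hlt | hge
    · refine ⟨L.topPrice, right_mem_Icc.2 hp, ?_⟩
      rw [L.loss_topPrice]
      have h1 : L.topPrice * (d - L.totalSize) ≤ 0 :=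
        mul_nonpos_of_nonneg_of_nonpos hp (by linarith)
      have h2 : 0 ≤ ((r + 1 : ℕ) : ℝ) * (L.totalSize ^ 2 / (2 * κ)) := by positivity
      linarith [L.optimalValue_nonneg (r + 1) d]
    -- The minimiser for r periods serves as the witness for r + 1 periods.
    obtain ⟨x, hx, hmin⟩ := L.exists_regularized_min r (d - L.totalSize) κ
    refine ⟨x, hx, ?_⟩
    set e := L.totalSize ^ 2 / (2 * κ) with he_def
    set c := x * (d - L.totalSize) + r * L.loss x + κ * x ^ 2 - κ * L.topPrice ^ 2 - r * e
      with hc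
    suffices h : (c - e) + L.loss x ≤ L.optimalValue (r + 1) d by
      push_cast
      linarith
    have hv : c ≤ L.optimalValue r d := by
      obtain ⟨x', hx', h⟩ := ih hd
      have h1 := hmin x' hx'
      have h2 : 0 ≤ κ / 2 * (x' - x) ^ 2 := by positivity
      linarith
    rw [loss, ← L.average_const_add, optimalValue]
    refine L.average_mono fun i j => ?_
    by_cases hi : i = 0
    · rw [hi, L.price_zero, max_eq_right (by linarith [hx.1]), mul_zero]
      linarith [L.le_payoff (L.optimalValue r) d 0 j]
    have hjS := L.size_le_totalSize j
    have hj0 := L.size_pos j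
    have hj : L.size j ≤ d := hjS.trans hge
    -- The minimiser x' for the reduced stock may differ from x; quadratic growth absorbs q(x' - x)
    -- up to q²/(2κ) ≤ e by completing the square.
    have hacc : c - e - L.size j * x ≤ L.optimalValue r (d - L.size j) := by
      obtain ⟨x', hx', h⟩ := ih (sub_nonneg.2 hj)
      have h1 := hmin x' hx'
      have h2 : L.size j * (x' - x) ≤ κ / 2 * (x' - x) ^ 2 + e := by
        have h3 : L.size j ^ 2 / (2 * κ) ≤ e := by
          rw [he_def]
          gcongr
        have h4 : κ / 2 * (x' - x) ^ 2 + L.size j ^ 2 / (2 * κ) - L.size j * (x' - x) =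
            (κ * (x' - x) - L.size j) ^ 2 / (2 * κ) := by
          field_simp
          ring
        have h5 : 0 ≤ (κ * (x' - x) - L.size j) ^ 2 / (2 * κ) := by positivity
        linarith
      linarith
    rw [payoff, if_pos ⟨hi, hj⟩]
    rcases le_total (L.price i - x) 0 with hpx | hpx
    · rw [max_eq_right hpx, mul_zero]
      exact le_max_of_le_right (by linarith)
    · rw [max_eq_left hpx]
      exact le_max_of_le_left (by linarith)

theorem fluid_le_optimalValue {κ : ℝ} (hκ : 0 < κ) (r : ℕ) {d : ℝ} (hd : 0 ≤ d) :
    L.fluid r d ≤ L.optimalValue r d + L.topPrice * L.totalSize + κ * L.topPrice ^ 2 +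
      r * (L.totalSize ^ 2 / (2 * κ)) := by
  obtain ⟨x, hx, h⟩ := L.exists_regularized_le_optimalValue hκ r hd
  have h1 := L.fluid_le r d hx
  have h2 := mul_le_mul_of_nonneg_right hx.2 L.totalSize_nonneg
  have h3 : 0 ≤ κ * x ^ 2 := by positivity
  linarith

end RequestLaw

/-! ### Averaging over one coordinate of an independent sequence. -/

section Independence

variable {Ω ι : Type*} [MeasurableSpace Ω] {μ : Measure Ω}

/-- Passing to a finite tuple over a finite discrete space makes measurability and integrability
automatic. -/
theorem exists_eq_comp_range_restrict {f : (ℕ → ι) → ℝ} {n : ℕ} (hf : DependsOn f (Iio n))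
    (y₀ : ℕ → ι) : ∃ f' : (Finset.range n → ι) → ℝ, ∀ y, f y = f' fun i => y i := by
  refine ⟨fun z => f fun m => if h : m ∈ Finset.range n then z ⟨m, h⟩ else y₀ m, fun y => ?_⟩
  refine hf fun m hm => ?_
  have : m ∈ Finset.range n := Finset.mem_range.2 hm
  simp only [this, dif_pos]

variable [IsProbabilityMeasure μ] [Fintype ι] [MeasurableSpace ι] [DiscreteMeasurableSpace ι]
  {Y : ℕ → Ω → ι}

theorem integrable_of_dependsOn (hY : ∀ n, Measurable (Y n)) {f : (ℕ → ι) → ℝ} {n : ℕ}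
    (hf : DependsOn f (Iio n)) : Integrable (fun ω => f fun m => Y m ω) μ := by
  obtain ⟨ω₀⟩ : Nonempty Ω := μ.nonempty_of_neZero
  obtain ⟨f', hf'⟩ := exists_eq_comp_range_restrict hf fun m => Y m ω₀
  simp_rw [hf']
  have hW : Measurable fun ω (i : Finset.range n) => Y i ω := measurable_pi_lambda _ fun i => hY i
  have : IsFiniteMeasure (μ.map fun ω (i : Finset.range n) => Y i ω) :=
    Measure.isFiniteMeasure_map μ _
  exact (Integrable.of_finite (f := f')).comp_measurable hW

/-- Averaging over the last coordinate of an independent sequence. -/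
theorem integral_le_of_average_update_le (hY : ∀ n, Measurable (Y n)) (hind : iIndepFun Y μ)
    {n : ℕ} {f g : (ℕ → ι) → ℝ} (hf : DependsOn f (Iio (n + 1))) (hg : DependsOn g (Iio n))
    (h : ∀ y, ∑ a, μ.real (Y n ⁻¹' {a}) * f (Function.update y n a) ≤ g y) :
    ∫ ω, f (fun m => Y m ω) ∂μ ≤ ∫ ω, g (fun m => Y m ω) ∂μ := by
  classical
  obtain ⟨ω₀⟩ : Nonempty Ω := μ.nonempty_of_neZero
  have hfa : ∀ a, DependsOn (fun y => f (Function.update y n a)) (Iio n) := by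
    intro a y y' hyy
    refine hf fun m hm => ?_
    rcases (Nat.lt_succ_iff.1 hm).eq_or_lt with rfl | hm
    · simp
    · rw [Function.update_of_ne hm.ne, Function.update_of_ne hm.ne, hyy m hm]
  -- Split by the value of the last coordinate; each summand is then a product of independent
  -- factors.
  have hsplit : ∀ ω, f (fun m => Y m ω) = ∑ a, (Y n ⁻¹' {a}).indicator 1 ω *
      f (Function.update (fun m => Y m ω) n a) := by
    intro ω
    rw [Finset.sum_eq_single (Y n ω)]
    · rw [Function.update_eq_self n (fun m => Y m ω)]
      simp
    · intro a _ ha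
      rw [indicator_of_notMem (by simpa using ha.symm), zero_mul]
    · simp
  have hmeas : ∀ a, MeasurableSet (Y n ⁻¹' {a}) := fun a => hY n (measurableSet_singleton a)
  have hint : ∀ a, Integrable (fun ω => (Y n ⁻¹' {a}).indicator 1 ω *
      f (Function.update (fun m => Y m ω) n a)) μ := fun a => by
    refine ((integrable_of_dependsOn hY (hfa a)).indicator (hmeas a)).congr (ae_of_all _ fun ω => ?_)
    by_cases hω : ω ∈ Y n ⁻¹' {a} <;> simp [hω]
  have hfactor : ∀ a, ∫ ω, (Y n ⁻¹' {a}).indicator 1 ω *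
      f (Function.update (fun m => Y m ω) n a) ∂μ =
      μ.real (Y n ⁻¹' {a}) * ∫ ω, f (Function.update (fun m => Y m ω) n a) ∂μ := by
    intro a
    obtain ⟨f', hf'⟩ := exists_eq_comp_range_restrict (hfa a) fun m => Y m ω₀
    simp_rw [hf']
    have hI := hind.indepFun_finset {n} (Finset.range n) (by simp) hY
    have hI' := hI.comp (φ := fun z : ({n} : Finset ℕ) → ι =>
      ({a} : Set ι).indicator (1 : ι → ℝ) (z ⟨n, by simp⟩)) (ψ := f')
      Measurable.of_discrete Measurable.of_discrete
    have hW : Measurable fun ω (i : Finset.range n) => Y i ω :=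
      measurable_pi_lambda _ fun i => hY i
    have := hI'.integral_fun_mul_eq_mul_integral
      ((Measurable.of_discrete (f := ({a} : Set ι).indicator (1 : ι → ℝ))).comp
        (hY n)).aestronglyMeasurable
      ((Measurable.of_discrete (f := f')).comp hW).aestronglyMeasurable
    refine Eq.trans this ?_
    congr 1
    rw [← integral_indicator_one (hmeas a)]
    rfl
  calc ∫ ω, f (fun m => Y m ω) ∂μ
      = ∑ a, μ.real (Y n ⁻¹' {a}) * ∫ ω, f (Function.update (fun m => Y m ω) n a) ∂μ := by
        simp_rw [hsplit]
        rw [integral_finsetSum _ fun a _ => hint a]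
        exact Finset.sum_congr rfl fun a _ => hfactor a
    _ = ∫ ω, ∑ a, μ.real (Y n ⁻¹' {a}) * f (Function.update (fun m => Y m ω) n a) ∂μ := by
        rw [integral_finsetSum _ fun a _ => (integrable_of_dependsOn hY (hfa a)).const_mul _]
        exact Finset.sum_congr rfl fun a _ => (integral_const_mul _ _).symm
    _ ≤ ∫ ω, g (fun m => Y m ω) ∂μ :=
        integral_mono (integrable_finsetSum _ fun a _ =>
          (integrable_of_dependsOn hY (hfa a)).const_mul _)
          (integrable_of_dependsOn hY hg) fun ω => h _

end Independence

/-! ### Concentration of the reward by a martingale argument. -/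

namespace RequestLaw

variable {ℓ k : ℕ} (L : RequestLaw ℓ k)

/-- The prices in the periods `1, 2, …` belonging to a sequence of indices. -/
def priceSeq (y : ℕ → Fin (ℓ + 1) × Fin k) (s : ℕ) : ℝ := L.price (y (s - 1)).1

/-- The sizes in the periods `1, 2, …` belonging to a sequence of indices. -/
def sizeSeq (y : ℕ → Fin (ℓ + 1) × Fin k) (s : ℕ) : ℝ := L.size (y (s - 1)).2

/-- The reward collected in `m` periods from period `τ + 1` on, plus the value of the stock that
is left. -/
def potential (N τ : ℕ) (d : ℝ) (m : ℕ) (y : ℕ → Fin (ℓ + 1) × Fin k) : ℝ :=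
  (L.run N (L.priceSeq y) (L.sizeSeq y) (τ + 1) d m).2 +
    L.optimalValue (N - (τ + m)) (L.run N (L.priceSeq y) (L.sizeSeq y) (τ + 1) d m).1

theorem run_succ_of_accepts {N : ℕ} {P Q : ℕ → ℝ} {t m : ℕ} {d : ℝ}
    (h : L.Accepts N (t + m) (L.run N P Q t d m).1 (P (t + m)) (Q (t + m))) :
    L.run N P Q t d (m + 1) = ((L.run N P Q t d m).1 - Q (t + m),
      (L.run N P Q t d m).2 + P (t + m) * Q (t + m)) :=
  if_pos h

theorem run_succ_of_not_accepts {N : ℕ} {P Q : ℕ → ℝ} {t m : ℕ} {d : ℝ}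
    (h : ¬ L.Accepts N (t + m) (L.run N P Q t d m).1 (P (t + m)) (Q (t + m))) :
    L.run N P Q t d (m + 1) = L.run N P Q t d m :=
  if_neg h

theorem run_congr {N : ℕ} {P Q P' Q' : ℕ → ℝ} {t m : ℕ} (d : ℝ)
    (h : ∀ s, t ≤ s → s < t + m → P s = P' s ∧ Q s = Q' s) :
    L.run N P Q t d m = L.run N P' Q' t d m := by
  induction m with
  | zero => rfl
  | succ m ih =>
    obtain ⟨hP, hQ⟩ := h (t + m) (by omega) (by omega)
    have ih := ih fun s h1 h2 => h s h1 (by omega)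
    by_cases hacc : L.Accepts N (t + m) (L.run N P Q t d m).1 (P (t + m)) (Q (t + m))
    · rw [run_succ_of_accepts L hacc]
      rw [ih, hP, hQ] at hacc
      rw [run_succ_of_accepts L hacc, ih, hP, hQ]
    · rw [run_succ_of_not_accepts L hacc]
      rw [ih, hP, hQ] at hacc
      rw [run_succ_of_not_accepts L hacc, ih]

theorem dependsOn_run (N τ : ℕ) (d : ℝ) (m : ℕ) :
    DependsOn (fun y => L.run N (L.priceSeq y) (L.sizeSeq y) (τ + 1) d m) (Iio (τ + m)) := by
  refine fun y y' h => L.run_congr d fun s h1 h2 => ?_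
  have : y (s - 1) = y' (s - 1) := h _ (by simp only [mem_Iio]; omega)
  simp [priceSeq, sizeSeq, this]

theorem dependsOn_potential (N τ : ℕ) (d : ℝ) (m : ℕ) :
    DependsOn (L.potential N τ d m) (Iio (τ + m)) := by
  intro y y' h
  have := L.dependsOn_run N τ d m h
  simp only at this
  simp only [potential, this]

theorem value_eq_optimalValue {N s : ℕ} (hs : 1 ≤ s) (hsN : s ≤ N) (d : ℝ) :
    L.value N s d = L.optimalValue (N + 1 - s) d := by
  rw [value, max_eq_left hs, valueToGo_eq_optimalValue]
  congr 1
  omega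

/-- In the last period both optimal values are 0, so the inequality holds automatically and the
exceptional clause disappears. -/
theorem accepts_iff {N s : ℕ} (hs : s < N) (d : ℝ) (i : Fin (ℓ + 1)) (j : Fin k) :
    L.Accepts N (s + 1) d (L.price i) (L.size j) ↔ (i ≠ 0 ∧ L.size j ≤ d) ∧
      L.optimalValue (N - s - 1) d ≤
        L.price i * L.size j + L.optimalValue (N - s - 1) (d - L.size j) := by
  have h0 : 0 ≤ L.price i * L.size j := mul_nonneg (L.price_nonneg i) (L.size_pos j).le
  rw [Accepts, Ne, L.price_eq_zero_iff, and_assoc]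
  rcases (Nat.succ_le_iff.2 hs).eq_or_lt with h | h
  · simp [optimalValue, h0, ← h]
  · have h' : ¬ s + 1 = N := by omega
    rw [L.value_eq_optimalValue (by omega) (by omega), L.value_eq_optimalValue (by omega) (by omega)]
    have : N + 1 - (s + 1 + 1) = N - s - 1 := by omega
    simp [this, h']

/-- The acceptance rule realises the maximum in `payoff`. Averaging over the fresh request therefore
gives back the previous potential, which is the martingale property. -/
theorem potential_succ_update {N τ m : ℕ} (h : τ + m < N) (d : ℝ)
    (y : ℕ → Fin (ℓ + 1) × Fin k) (a : Fin (ℓ + 1) × Fin k) :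
    L.potential N τ d (m + 1) (Function.update y (τ + m) a) =
      (L.run N (L.priceSeq y) (L.sizeSeq y) (τ + 1) d m).2 +
        L.payoff (L.optimalValue (N - (τ + m) - 1))
          (L.run N (L.priceSeq y) (L.sizeSeq y) (τ + 1) d m).1 a.1 a.2 := by
  have hrun : L.run N (L.priceSeq (Function.update y (τ + m) a))
      (L.sizeSeq (Function.update y (τ + m) a)) (τ + 1) d m =
      L.run N (L.priceSeq y) (L.sizeSeq y) (τ + 1) d m :=
    L.dependsOn_run N τ d m fun i hi => Function.update_of_ne (ne_of_lt hi) _ _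
  have hidx : τ + 1 + m = τ + m + 1 := by omega
  have hN : N - (τ + (m + 1)) = N - (τ + m) - 1 := by omega
  have hp : L.priceSeq (Function.update y (τ + m) a) (τ + 1 + m) = L.price a.1 := by
    simp [priceSeq, hidx]
  have hq : L.sizeSeq (Function.update y (τ + m) a) (τ + 1 + m) = L.size a.2 := by
    simp [sizeSeq, hidx]
  have hacc := L.accepts_iff h (L.run N (L.priceSeq y) (L.sizeSeq y) (τ + 1) d m).1 a.1 a.2
  rw [potential, hN, payoff]
  by_cases hfit : a.1 ≠ 0 ∧ L.size a.2 ≤ (L.run N (L.priceSeq y) (L.sizeSeq y) (τ + 1) d m).1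
  · by_cases hv : L.optimalValue (N - (τ + m) - 1)
        (L.run N (L.priceSeq y) (L.sizeSeq y) (τ + 1) d m).1 ≤ L.price a.1 * L.size a.2 +
          L.optimalValue (N - (τ + m) - 1)
            ((L.run N (L.priceSeq y) (L.sizeSeq y) (τ + 1) d m).1 - L.size a.2)
    · rw [run_succ_of_accepts L (by rw [hrun, hp, hq, hidx]; exact hacc.2 ⟨hfit, hv⟩), hrun, hp,
        hq, if_pos hfit, max_eq_left hv]
      ring
    · rw [run_succ_of_not_accepts L
        (by rw [hrun, hp, hq, hidx]; exact fun h => hv (hacc.1 h).2), hrun, if_pos hfit,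
        max_eq_right (not_le.1 hv).le]
  · rw [run_succ_of_not_accepts L
      (by rw [hrun, hp, hq, hidx]; exact fun h => hfit (hacc.1 h).1), hrun, if_neg hfit]

/-- The moment generating function of a bounded centred variable. -/
theorem average_exp_le {f : Fin (ℓ + 1) → Fin k → ℝ} {C η : ℝ} (hf : ∀ i j, |f i j| ≤ C)
    (hmean : ∑ i, ∑ j, L.prob i j * f i j = 0) (hη : |η| * C ≤ 1) :
    ∑ i, ∑ j, L.prob i j * Real.exp (η * f i j) ≤ Real.exp (η ^ 2 * C ^ 2) := by
  have h : ∀ i j, Real.exp (η * f i j) ≤ (1 + η ^ 2 * C ^ 2) + η * f i j := by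
    intro i j
    have h1 : |η * f i j| ≤ |η| * C := by
      rw [abs_mul]
      exact mul_le_mul_of_nonneg_left (hf i j) (abs_nonneg η)
    have h2 := (abs_le.1 (Real.abs_exp_sub_one_sub_id_le (h1.trans hη))).2
    have h3 : (η * f i j) ^ 2 ≤ η ^ 2 * C ^ 2 := by
      rw [← sq_abs η, ← mul_pow, ← sq_abs (η * f i j)]
      exact pow_le_pow_left₀ (abs_nonneg _) h1 2
    linarith
  refine (L.average_mono h).trans ?_
  rw [L.average_const_add]
  have : ∑ i, ∑ j, L.prob i j * (η * f i j) = η * ∑ i, ∑ j, L.prob i j * f i j := by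
    simp_rw [Finset.mul_sum]
    exact Finset.sum_congr rfl fun i _ => Finset.sum_congr rfl fun j _ => by ring
  rw [this, hmean, mul_zero, add_zero, add_comm]
  exact Real.add_one_le_exp _

variable {Ω : Type*} [MeasurableSpace Ω] {μ : Measure Ω} [IsProbabilityMeasure μ]
  {Y : ℕ → Ω → Fin (ℓ + 1) × Fin k}

/-- Each martingale increment is centred and bounded by `topPrice * totalSize`, so one period
multiplies the exponential moment by at most the bound of `average_exp_le`. -/
theorem integral_exp_potential_le (hY : ∀ n, Measurable (Y n)) (hind : iIndepFun Y μ)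
    (hlaw : ∀ n a, μ.real (Y n ⁻¹' {a}) = L.prob a.1 a.2) {N τ : ℕ} (d : ℝ) {η : ℝ}
    (hη : |η| * (L.topPrice * L.totalSize) ≤ 1) {m : ℕ} (hm : τ + m ≤ N) :
    ∫ ω, Real.exp (η * (L.potential N τ d m (fun n => Y n ω) - L.optimalValue (N - τ) d)) ∂μ ≤
      Real.exp (η ^ 2 * (L.topPrice * L.totalSize) ^ 2) ^ m := by
  set C := L.topPrice * L.totalSize
  induction m with
  | zero => simp [potential, run]
  | succ m ih =>
    refine (integral_le_of_average_update_le hY hind (n := τ + m)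
      (f := fun y => Real.exp (η * (L.potential N τ d (m + 1) y - L.optimalValue (N - τ) d)))
      (g := fun y => Real.exp (η ^ 2 * C ^ 2) *
        Real.exp (η * (L.potential N τ d m y - L.optimalValue (N - τ) d)))
      (fun y y' h => ?_) (fun y y' h => ?_) fun y => ?_).trans ?_
    · simp only [L.dependsOn_potential N τ d (m + 1) h]
    · simp only [L.dependsOn_potential N τ d m h]
    · simp only [L.potential_succ_update (show τ + m < N by omega), hlaw]
      rw [potential]
      set z := L.run N (L.priceSeq y) (L.sizeSeq y) (τ + 1) d m
      set v := L.optimalValue (N - (τ + m) - 1)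
      have hv : L.optimalValue (N - (τ + m)) z.1 =
          ∑ i, ∑ j, L.prob i j * L.payoff v z.1 i j := by
        have : N - (τ + m) = N - (τ + m) - 1 + 1 := by omega
        rw [this, optimalValue]
      set V := L.optimalValue (N - (τ + m)) z.1
      have hlow : ∀ i j, v z.1 ≤ L.payoff v z.1 i j := L.le_payoff v z.1
      have hupp : ∀ i j, L.payoff v z.1 i j ≤ v z.1 + C :=
        L.payoff_le (L.monotone_optimalValue _) z.1
      have hV1 : v z.1 ≤ V := by
        rw [hv, ← L.average_const (v z.1)]
        exact L.average_mono hlow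
      have hV2 : V ≤ v z.1 + C := by
        rw [hv, ← L.average_const (v z.1 + C)]
        exact L.average_mono hupp
      have key := L.average_exp_le (f := fun i j => -V + L.payoff v z.1 i j) (C := C) (η := η)
        (fun i j => abs_le.2 ⟨by linarith [hlow i j], by linarith [hupp i j]⟩)
        (by rw [L.average_const_add, ← hv]; ring) hη
      refine le_trans (le_of_eq ?_) (mul_le_mul_of_nonneg_right key (Real.exp_nonneg _))
      rw [Fintype.sum_prod_type, Finset.sum_mul]
      refine Finset.sum_congr rfl fun i _ => ?_
      rw [Finset.sum_mul]
      refine Finset.sum_congr rfl fun j _ => ?_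
      rw [mul_assoc, ← Real.exp_add]
      congr 2
      ring
    · rw [integral_const_mul, pow_succ' (Real.exp _) m]
      exact mul_le_mul_of_nonneg_left (ih (by omega)) (Real.exp_nonneg _)

theorem potential_eq_reward {N τ : ℕ} (hτ : τ < N) (d : ℝ) (y : ℕ → Fin (ℓ + 1) × Fin k) :
    L.potential N τ d (N - τ) y = L.reward N (L.priceSeq y) (L.sizeSeq y) (τ + 1) d N := by
  have h1 : N - (τ + (N - τ)) = 0 := by omega
  have h2 : N + 1 - (τ + 1) = N - τ := by omega
  rw [potential, reward, h1, h2, optimalValue, add_zero]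

/-- Chernoff bounds with parameters η and -η for the two tails. -/
theorem measureReal_deviation_le (hY : ∀ n, Measurable (Y n)) (hind : iIndepFun Y μ)
    (hlaw : ∀ n a, μ.real (Y n ⁻¹' {a}) = L.prob a.1 a.2) {N τ : ℕ} (hτ : τ < N) (d : ℝ)
    {η : ℝ} (hη0 : 0 ≤ η) (hη : η * (L.topPrice * L.totalSize) ≤ 1) (b : ℝ) :
    μ.real {ω | b ≤ |L.reward N (L.priceSeq fun n => Y n ω) (L.sizeSeq fun n => Y n ω)
        (τ + 1) d N - L.optimalValue (N - τ) d|} ≤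
      2 * Real.exp (η ^ 2 * (L.topPrice * L.totalSize) ^ 2 * N - η * b) := by
  set C := L.topPrice * L.totalSize
  set X : Ω → ℝ := fun ω => L.potential N τ d (N - τ) (fun n => Y n ω) - L.optimalValue (N - τ) d
    with hX
  have hpow : Real.exp (η ^ 2 * C ^ 2) ^ (N - τ) ≤ Real.exp (η ^ 2 * C ^ 2 * N) := by
    rw [← Real.exp_nat_mul, mul_comm (η ^ 2 * C ^ 2)]
    exact Real.exp_le_exp.2 (mul_le_mul_of_nonneg_right (by exact_mod_cast Nat.sub_le N τ)
      (by positivity))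
  have hint : ∀ c : ℝ, Integrable (fun ω => Real.exp (c * X ω)) μ := fun c =>
    integrable_of_dependsOn hY (n := τ + (N - τ))
      (f := fun y => Real.exp (c * (L.potential N τ d (N - τ) y - L.optimalValue (N - τ) d)))
      fun y y' h => by simp only [L.dependsOn_potential N τ d (N - τ) h]
  have hmgf : ∀ c : ℝ, |c| = η → mgf X μ c ≤ Real.exp (η ^ 2 * C ^ 2 * N) := fun c hc => by
    have := L.integral_exp_potential_le hY hind hlaw (N := N) (τ := τ) d (η := c)
      (by rw [hc]; exact hη) (m := N - τ) (by omega)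
    rw [← sq_abs c, hc] at this
    exact this.trans hpow
  have hu := (measure_ge_le_exp_mul_mgf b hη0 (hint η)).trans
    (mul_le_mul_of_nonneg_left (hmgf η (abs_of_nonneg hη0)) (Real.exp_nonneg _))
  have hl := (measure_le_le_exp_mul_mgf (-b) (neg_nonpos.2 hη0) (hint (-η))).trans
    (mul_le_mul_of_nonneg_left (hmgf (-η) (by rw [abs_neg, abs_of_nonneg hη0]))
      (Real.exp_nonneg _))
  rw [← Real.exp_add] at hu hl
  have hsub : {ω | b ≤ |L.reward N (L.priceSeq fun n => Y n ω) (L.sizeSeq fun n => Y n ω)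
        (τ + 1) d N - L.optimalValue (N - τ) d|} ⊆ {ω | b ≤ X ω} ∪ {ω | X ω ≤ -b} := by
    intro ω hω
    simp only [mem_ofPred_eq, ← L.potential_eq_reward hτ] at hω
    rcases le_abs.1 hω with h | h
    · exact Or.inl h
    · exact Or.inr (by simp only [mem_ofPred_eq, hX]; linarith)
  refine (measureReal_mono hsub).trans ((measureReal_union_le _ _).trans ?_)
  have e1 : -η * b + η ^ 2 * C ^ 2 * N = η ^ 2 * C ^ 2 * N - η * b := by ring
  have e2 : -(-η) * -b + η ^ 2 * C ^ 2 * N = η ^ 2 * C ^ 2 * N - η * b := by ring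
  rw [e1] at hu
  rw [e2] at hl
  linarith

/-- Almost surely, the rewards of the optimal policy deviate from their expectations by `o(n)`,
uniformly in the starting period and the initial stock. -/
theorem ae_eventually_deviation_lt (hY : ∀ n, Measurable (Y n)) (hind : iIndepFun Y μ)
    (hlaw : ∀ n a, μ.real (Y n ⁻¹' {a}) = L.prob a.1 a.2) (T M : ℕ) {ε : ℝ} (hε : 0 < ε) :
    ∀ᵐ ω ∂μ, ∀ᶠ n : ℕ in atTop, ∀ τ < n * T, ∀ d ≤ n * M,
      |L.reward (n * T) (L.priceSeq fun n => Y n ω) (L.sizeSeq fun n => Y n ω) (τ + 1) d (n * T) -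
        L.optimalValue (n * T - τ) d| < ε * n := by
  set C := L.topPrice * L.totalSize
  have hC : 0 ≤ C := mul_nonneg L.topPrice_nonneg L.totalSize_nonneg
  -- For this η the variance term η²C²nT is at most half of ηεn, leaving the tail exp(-ηεn/2).
  obtain ⟨η, hη0, hη1, hη2⟩ : ∃ η : ℝ, 0 < η ∧ η * C ≤ 1 ∧ η * C ^ 2 * T ≤ ε / 2 := by
    refine ⟨min (1 / (C + 1)) (ε / (2 * (C ^ 2 * T + 1))), by positivity, ?_, ?_⟩
    · refine (mul_le_mul_of_nonneg_right (min_le_left _ _) hC).trans ?_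
      rw [div_mul_eq_mul_div, div_le_one (by positivity)]
      linarith
    · rw [mul_assoc]
      refine (mul_le_mul_of_nonneg_right (min_le_right _ _) (by positivity)).trans ?_
      rw [div_mul_eq_mul_div, div_le_div_iff₀ (by positivity) (by norm_num)]
      nlinarith [show 0 ≤ C ^ 2 * T by positivity]
  set B : ℕ → ℕ → ℕ → Set Ω := fun n τ d =>
    {ω | ε * n ≤ |L.reward (n * T) (L.priceSeq fun n => Y n ω) (L.sizeSeq fun n => Y n ω) (τ + 1) d
      (n * T) - L.optimalValue (n * T - τ) d|}
  set A : ℕ → Set Ω := fun n =>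
    ⋃ τ ∈ Finset.range (n * T), ⋃ d ∈ Finset.range (n * M + 1), B n τ d
  -- Union bound over nT(nM + 1) starting states, hence the powers n² and n.
  have hbound : ∀ n : ℕ, μ.real (A n) ≤
      2 * (T * M) * ((n : ℝ) ^ 2 * Real.exp (-(η * ε / 2) * n)) +
        2 * T * ((n : ℝ) ^ 1 * Real.exp (-(η * ε / 2) * n)) := by
    intro n
    have h1 : ∀ τ ∈ Finset.range (n * T), ∀ d ∈ Finset.range (n * M + 1),
        μ.real (B n τ d) ≤ 2 * Real.exp (-(η * ε / 2) * n) := by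
      intro τ hτ d _
      refine (L.measureReal_deviation_le hY hind hlaw (Finset.mem_range.1 hτ) d hη0.le hη1
        (ε * n)).trans ?_
      refine mul_le_mul_of_nonneg_left (Real.exp_le_exp.2 ?_) (by norm_num)
      have := mul_le_mul_of_nonneg_right hη2 (show (0 : ℝ) ≤ η * n by positivity)
      push_cast
      linarith
    refine (measureReal_biUnion_finset_le _ _).trans ((Finset.sum_le_sum fun τ hτ =>
      (measureReal_biUnion_finset_le _ _).trans (Finset.sum_le_sum (h1 τ hτ))).trans (le_of_eq ?_))
    simp only [Finset.sum_const, Finset.card_range, nsmul_eq_mul]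
    push_cast
    ring
  have hsum : ∑' n, μ (A n) ≠ ⊤ := by
    have hr : 0 < η * ε / 2 := by positivity
    have hs := ((Real.summable_pow_mul_exp_neg_nat_mul 2 hr).mul_left (2 * (T * M : ℝ))).add
      ((Real.summable_pow_mul_exp_neg_nat_mul 1 hr).mul_left (2 * T : ℝ))
    have hs' : Summable fun n => μ.real (A n) :=
      hs.of_nonneg_of_le (fun n => measureReal_nonneg) hbound
    have : ∀ n, μ (A n) = ENNReal.ofReal (μ.real (A n)) := fun n =>
      (ofReal_measureReal (measure_ne_top _ _)).symm
    simp_rw [this]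
    exact hs'.tsum_ofReal_ne_top
  filter_upwards [ae_eventually_notMem hsum] with ω hω
  filter_upwards [hω] with n hn τ hτ d hd
  by_contra hcon
  refine hn (mem_iUnion₂.2 ⟨τ, Finset.mem_range.2 hτ, mem_iUnion₂.2
    ⟨d, Finset.mem_range.2 (Nat.lt_succ_iff.2 hd), not_lt.1 hcon⟩⟩)

end RequestLaw

/-! ### Weak derivatives of Lipschitz functions and superdifferentials of cones. -/

theorem partialX_eq_lineDeriv (u : ℝ × ℝ → ℝ) (z : ℝ × ℝ) :
    partialX u z = lineDeriv ℝ u z (1, 0) := by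
  have := deriv_comp_const_add (fun x => u (x, z.2)) z.1 0
  rw [add_zero] at this
  rw [partialX, ← this, lineDeriv]
  exact congrArg (deriv · 0) (funext fun t => congrArg u (by ext <;> simp))

theorem partialY_eq_lineDeriv (u : ℝ × ℝ → ℝ) (z : ℝ × ℝ) :
    partialY u z = lineDeriv ℝ u z (0, 1) := by
  have := deriv_comp_const_add (fun y => u (z.1, y)) z.2 0
  rw [add_zero] at this
  rw [partialY, ← this, lineDeriv]
  exact congrArg (deriv · 0) (funext fun t => congrArg u (by ext <;> simp))

theorem Filter.EventuallyEq.partialX_eq {u v : ℝ × ℝ → ℝ} {z : ℝ × ℝ} (h : u =ᶠ[𝓝 z] v) :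
    partialX u z = partialX v z := by
  rw [partialX_eq_lineDeriv, partialX_eq_lineDeriv, h.lineDeriv_eq]

theorem Filter.EventuallyEq.partialY_eq {u v : ℝ × ℝ → ℝ} {z : ℝ × ℝ} (h : u =ᶠ[𝓝 z] v) :
    partialY u z = partialY v z := by
  rw [partialY_eq_lineDeriv, partialY_eq_lineDeriv, h.lineDeriv_eq]

/-- Integration by parts for a Lipschitz function and a test function. -/
theorem LipschitzWith.integral_mul_lineDeriv_testFunction {u φ : ℝ × ℝ → ℝ} {C : NNReal}
    (hu : LipschitzWith C u) {U : Set (ℝ × ℝ)} (hφ : IsTestFunction U φ)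
    (v : ℝ × ℝ) :
    ∫ z in U, u z * lineDeriv ℝ φ z v = - ∫ z in U, lineDeriv ℝ u z v * φ z := by
  obtain ⟨hsmooth, hcomp, hsupp⟩ := hφ
  have hdiff : Differentiable ℝ φ := hsmooth.differentiable (by simp)
  obtain ⟨D, hD⟩ := ContDiff.lipschitzWith_of_hasCompactSupport hcomp hsmooth (by simp)
  have hzero : ∀ z ∉ U, φ z = 0 := fun z hz => image_eq_zero_of_notMem_tsupport fun h => hz (hsupp h)
  have hderiv : ∀ z ∉ U, lineDeriv ℝ φ z v = 0 := fun z hz => by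
    have : φ =ᶠ[𝓝 z] 0 := notMem_tsupport_iff_eventuallyEq.1 fun h => hz (hsupp h)
    rw [this.lineDeriv_eq]
    simp [lineDeriv]
  rw [setIntegral_eq_integral_of_forall_compl_eq_zero fun z hz => by rw [hderiv z hz, mul_zero],
    setIntegral_eq_integral_of_forall_compl_eq_zero fun z hz => by rw [hzero z hz, mul_zero],
    hu.integral_lineDeriv_mul_eq hD hcomp, ← integral_neg]
  refine integral_congr_ae (ae_of_all _ fun z => ?_)
  simp only [(hdiff z).lineDeriv_eq_fderiv, map_neg]
  ring

/-- The superdifferentials of a function that is positively homogeneous about a point `v` to the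
right of `U` lie in the boundary of a convex set. -/
theorem volume_iUnion_superdifferential_eq_zero {U : Set (ℝ × ℝ)} (hU : IsOpen U)
    {u : ℝ × ℝ → ℝ} {v : ℝ × ℝ} (hleft : ∀ z ∈ U, z.1 < v.1)
    (hstar : ∀ z ∈ U, ∀ s ∈ Ioc (0 : ℝ) 1, v + s • (z - v) ∈ U)
    (hhom : ∀ z ∈ U, ∀ s : ℝ, 0 < s → u (v + s • (z - v)) = s * u z) :
    volume (⋃ z ∈ U, superdifferential U u z) = 0 := by
  -- The slopes of the affine functions that vanish at v and majorise u on U.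
  set E : Set (ℝ × ℝ) := {a | ∀ z ∈ U, u z ≤ a.1 * (z.1 - v.1) + a.2 * (z.2 - v.2)}
  have hconv : Convex ℝ E := by
    intro a ha b hb s t hs ht hst z hz
    have h1 := mul_le_mul_of_nonneg_left (ha z hz) hs
    have h2 := mul_le_mul_of_nonneg_left (hb z hz) ht
    have h3 : u z = s * u z + t * u z := by rw [← add_mul, hst, one_mul]
    simp only [Prod.fst_add, Prod.snd_add, Prod.smul_fst, Prod.smul_snd, smul_eq_mul]
    linarith
  refine measure_mono_null (iUnion₂_subset fun z hz a ha => ?_) (hconv.addHaar_frontier volume)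
  have hle : ∀ s : ℝ, 0 < s → v + s • (z - v) ∈ U →
      (s - 1) * (u z - (a.1 * (z.1 - v.1) + a.2 * (z.2 - v.2))) ≤ 0 := by
    intro s hs hsU
    have h := ha _ hsU
    rw [hhom z hz s hs] at h
    simp only [Prod.fst_add, Prod.snd_add, Prod.smul_fst, Prod.smul_snd, smul_eq_mul,
      Prod.fst_sub, Prod.snd_sub] at h
    linarith
  -- Along the ray from v both sides are linear in s; testing some s > 1 and s = 1/2 forces
  -- equality, so the supporting plane passes through v.
  have heq : u z = a.1 * (z.1 - v.1) + a.2 * (z.2 - v.2) := by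
    refine le_antisymm ?_ ?_
    · have hcont : Tendsto (fun s : ℝ => v + s • (z - v)) (𝓝 1) (𝓝 (v + (1 : ℝ) • (z - v))) :=
        Continuous.tendsto (by fun_prop) 1
      rw [one_smul, add_sub_cancel] at hcont
      obtain ⟨s, hs, hs1⟩ := (((hcont.eventually (hU.mem_nhds hz)).filter_mono
        nhdsWithin_le_nhds).and (self_mem_nhdsWithin (a := (1 : ℝ)) (s := Ioi 1))).exists
      have hs1 : 1 < s := hs1
      have := hle s (by linarith) hs
      nlinarith
    · have := hle (1 / 2) (by norm_num) (hstar z hz _ ⟨by norm_num, by norm_num⟩)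
      linarith
  have haE : a ∈ E := by
    intro z' hz'
    have := ha z' hz'
    rw [heq] at this
    linarith
  rw [frontier_eq_closure_inter_closure]
  refine ⟨subset_closure haE, ?_⟩
  -- Since z lies to the left of v, raising the first slope lowers the plane at the contact point z,
  -- so the perturbed slope leaves E.
  have hlim : Tendsto (fun ε : ℝ => (a.1 + ε, a.2)) (𝓝[>] 0) (𝓝 a) := by
    have : Tendsto (fun ε : ℝ => (a.1 + ε, a.2)) (𝓝 0) (𝓝 (a.1 + 0, a.2)) :=
      Continuous.tendsto (by fun_prop) 0
    rw [add_zero] at this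
    exact this.mono_left nhdsWithin_le_nhds
  refine mem_closure_of_tendsto hlim ?_
  filter_upwards [self_mem_nhdsWithin] with ε hε hmem
  have h1 := hmem z hz
  have h2 := mul_pos (show 0 < ε from hε) (sub_pos.2 (hleft z hz))
  simp only at h1
  linarith

/-! ### The limit function and the equations it satisfies. -/

namespace RequestLaw

variable {ℓ k : ℕ} (L : RequestLaw ℓ k)

theorem loss_le_loss_zero {x : ℝ} (hx : 0 ≤ x) : L.loss x ≤ L.loss 0 :=
  L.average_mono fun i j => mul_le_mul_of_nonneg_left
    (max_le_max (by linarith) le_rfl) (L.size_pos j).le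

theorem fluid_le_add (s y s' y' : ℝ) :
    L.fluid s y ≤ L.fluid s' y' + L.topPrice * |y - y'| + L.loss 0 * |s - s'| := by
  obtain ⟨i, hi⟩ := L.exists_fluid_eq s' y'
  rw [hi]
  refine (L.fluid_le_price s y i).trans ?_
  have h1 : L.price i * (y - y') ≤ L.topPrice * |y - y'| :=
    (mul_le_mul_of_nonneg_left (le_abs_self _) (L.price_nonneg i)).trans
      (mul_le_mul_of_nonneg_right (L.price_le_topPrice i) (abs_nonneg _))
  have h2 : (s - s') * L.loss (L.price i) ≤ L.loss 0 * |s - s'| := by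
    rw [mul_comm (L.loss 0)]
    exact (mul_le_mul_of_nonneg_right (le_abs_self _) (L.loss_nonneg _)).trans
      (mul_le_mul_of_nonneg_left (L.loss_le_loss_zero (L.price_nonneg i)) (abs_nonneg _))
  linarith

theorem fluid_smul {c : ℝ} (hc : 0 ≤ c) (s y : ℝ) : L.fluid (c * s) (c * y) = c * L.fluid s y := by
  refine le_antisymm ?_ ?_
  · obtain ⟨i, hi⟩ := L.exists_fluid_eq s y
    rw [hi]
    refine (L.fluid_le_price _ _ i).trans (le_of_eq (by ring))
  · obtain ⟨i, hi⟩ := L.exists_fluid_eq (c * s) (c * y)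
    rw [hi]
    refine (mul_le_mul_of_nonneg_left (L.fluid_le_price s y i) hc).trans (le_of_eq (by ring))

theorem fluid_nonneg {s y : ℝ} (hs : 0 ≤ s) (hy : 0 ≤ y) : 0 ≤ L.fluid s y := by
  obtain ⟨i, hi⟩ := L.exists_fluid_eq s y
  rw [hi]
  exact add_nonneg (mul_nonneg (L.price_nonneg i) hy) (mul_nonneg hs (L.loss_nonneg _))

theorem fluid_zero_time {y : ℝ} (hy : 0 ≤ y) : L.fluid 0 y = 0 :=
  le_antisymm ((L.fluid_le_price 0 y 0).trans (by simp [L.price_zero])) (L.fluid_nonneg le_rfl hy)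

theorem fluid_zero_stock {s : ℝ} (hs : 0 ≤ s) : L.fluid s 0 = 0 := by
  obtain ⟨i, hi⟩ := L.exists_price_eq_topPrice
  exact le_antisymm ((L.fluid_le_price s 0 i).trans (by simp [hi, L.loss_topPrice]))
    (L.fluid_nonneg hs le_rfl)

/-- The limit `u`: the fluid value with `T - x` units of time and `y` units of stock. -/
def limitValue (T : ℕ) (z : ℝ × ℝ) : ℝ := L.fluid (T - z.1) z.2

/-- The affine functions whose minimum is `limitValue`. -/
def limitPiece (T : ℕ) (i : Fin (ℓ + 1)) (z : ℝ × ℝ) : ℝ :=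
  L.price i * z.2 + (T - z.1) * L.loss (L.price i)

theorem lipschitzWith_limitValue (T : ℕ) :
    ∃ C : NNReal, LipschitzWith C (L.limitValue T) := by
  have h0 := L.loss_nonneg 0
  have h1 := L.topPrice_nonneg
  have key : ∀ z z', L.limitValue T z ≤ L.limitValue T z' + (L.topPrice + L.loss 0) * dist z z' := by
    intro z z'
    refine (L.fluid_le_add _ _ (T - z'.1) z'.2).trans ?_
    have h2 : |z.2 - z'.2| ≤ dist z z' := le_max_right _ _
    have h3 : |((T : ℝ) - z.1) - (T - z'.1)| ≤ dist z z' := by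
      rw [sub_sub_sub_cancel_left, abs_sub_comm]
      exact le_max_left (dist z.1 z'.1) _
    have h4 := mul_le_mul_of_nonneg_left h2 h1
    have h5 := mul_le_mul_of_nonneg_left h3 h0
    rw [limitValue]
    linarith
  exact ⟨⟨L.topPrice + L.loss 0, by positivity⟩, LipschitzWith.of_le_add_mul _ key⟩

theorem concaveOn_limitValue (T : ℕ) {U : Set (ℝ × ℝ)} (hU : Convex ℝ U) :
    ConcaveOn ℝ U (L.limitValue T) := by
  refine ⟨hU, fun z _ z' _ a b ha hb hab => ?_⟩
  obtain ⟨i, hi⟩ := L.exists_fluid_eq (T - (a • z + b • z').1) (a • z + b • z').2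
  have h1 := mul_le_mul_of_nonneg_left (L.fluid_le_price (T - z.1) z.2 i) ha
  have h2 := mul_le_mul_of_nonneg_left (L.fluid_le_price (T - z'.1) z'.2 i) hb
  rw [limitValue, limitValue, limitValue, hi]
  simp only [Prod.fst_add, Prod.snd_add, Prod.smul_fst, Prod.smul_snd, smul_eq_mul]
  have h3 : (T : ℝ) = a * T + b * T := by rw [← add_mul, hab, one_mul]
  have h4 : ((T : ℝ) - (a * z.1 + b * z'.1)) = a * (T - z.1) + b * (T - z'.1) := by linarith
  rw [h4]
  linarith

theorem limitValue_le_limitPiece (T : ℕ) (i : Fin (ℓ + 1)) (z : ℝ × ℝ) :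
    L.limitValue T z ≤ L.limitPiece T i z :=
  L.fluid_le_price _ _ i

theorem contDiff_limitPiece (T : ℕ) (i : Fin (ℓ + 1)) : ContDiff ℝ (⊤ : ℕ∞) (L.limitPiece T i) := by
  unfold limitPiece
  fun_prop

theorem partialX_limitPiece (T : ℕ) (i : Fin (ℓ + 1)) (z : ℝ × ℝ) :
    partialX (L.limitPiece T i) z = -L.loss (L.price i) := by
  have : HasDerivAt (fun x => L.price i * z.2 + ((T : ℝ) - x) * L.loss (L.price i))
      (-1 * L.loss (L.price i)) z.1 :=
    (((hasDerivAt_id z.1).const_sub (T : ℝ)).mul_const _).const_add _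
  rw [partialX]
  exact this.deriv.trans (by ring)

theorem partialY_limitPiece (T : ℕ) (i : Fin (ℓ + 1)) (z : ℝ × ℝ) :
    partialY (L.limitPiece T i) z = L.price i := by
  have : HasDerivAt (fun y => L.price i * y + ((T : ℝ) - z.1) * L.loss (L.price i))
      (L.price i * 1) z.2 :=
    ((hasDerivAt_id z.2).const_mul _).add_const _
  rw [partialY]
  exact this.deriv.trans (by ring)

/-- Where `limitValue` is differentiable, it agrees locally with one of its pieces. -/
theorem exists_eventuallyEq_limitPiece (T : ℕ) {z : ℝ × ℝ}
    (hz : DifferentiableAt ℝ (L.limitValue T) z) :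
    ∃ i, L.limitValue T =ᶠ[𝓝 z] L.limitPiece T i := by
  -- A piece touching u from above at z has the same gradient there; as the prices are distinct,
  -- only one piece can touch.
  have hslope : ∀ i, L.limitValue T z = L.limitPiece T i z →
      L.price i = lineDeriv ℝ (L.limitValue T) z (0, 1) := by
    intro i hi
    have hd : DifferentiableAt ℝ (L.limitPiece T i) z :=
      (L.contDiff_limitPiece T i).differentiable (by simp) z
    have hmin : IsLocalMin (fun z => L.limitPiece T i z - L.limitValue T z) z :=
      Eventually.of_forall fun z' => by
        simpa [hi] using L.limitValue_le_limitPiece T i z'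
    have h0 := hmin.fderiv_eq_zero
    rw [fderiv_fun_sub hd hz, sub_eq_zero] at h0
    rw [hz.lineDeriv_eq_fderiv, ← h0, ← hd.lineDeriv_eq_fderiv, ← partialY_eq_lineDeriv,
      partialY_limitPiece]
  obtain ⟨i, hi⟩ := L.exists_fluid_eq (T - z.1) z.2
  refine ⟨i, ?_⟩
  have hlt : ∀ j, j ≠ i → ∀ᶠ z' in 𝓝 z, L.limitPiece T i z' < L.limitPiece T j z' := by
    intro j hj
    refine (L.contDiff_limitPiece T i).continuous.continuousAt.eventually_lt
      (L.contDiff_limitPiece T j).continuous.continuousAt ?_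
    have hle : L.limitPiece T i z ≤ L.limitPiece T j z :=
      hi.symm.le.trans (L.limitValue_le_limitPiece T j z)
    refine lt_of_le_of_ne hle fun h => hj (L.price_injective ?_)
    rw [hslope i hi, hslope j (hi.trans h)]
  filter_upwards [eventually_all.2 fun j => eventually_imp_distrib_left.2 (hlt j)] with z' hz'
  obtain ⟨j, hj⟩ := L.exists_fluid_eq (T - z'.1) z'.2
  by_cases hji : j = i
  · rw [← hji]
    exact hj
  · exact absurd (L.limitValue_le_limitPiece T i z') (not_le.2 ((hz' j hji).trans_eq hj.symm))

theorem isOpen_differentiabilitySet (T : ℕ) {U : Set (ℝ × ℝ)} (hU : IsOpen U) :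
    IsOpen (differentiabilitySet U (L.limitValue T)) := by
  rw [isOpen_iff_mem_nhds]
  rintro z ⟨hzU, hz⟩
  obtain ⟨i, hi⟩ := L.exists_eventuallyEq_limitPiece T hz
  filter_upwards [hU.mem_nhds hzU, hi.eventuallyEq_nhds] with z' hz'U hz'
  exact ⟨hz'U, ((L.contDiff_limitPiece T i).differentiable (by simp) z').congr_of_eventuallyEq hz'⟩

theorem contDiffOn_limitValue (T : ℕ) (U : Set (ℝ × ℝ)) :
    ContDiffOn ℝ (⊤ : ℕ∞) (L.limitValue T) (differentiabilitySet U (L.limitValue T)) := by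
  rintro z ⟨_, hz⟩
  obtain ⟨i, hi⟩ := L.exists_eventuallyEq_limitPiece T hz
  exact ((L.contDiff_limitPiece T i).contDiffAt.congr_of_eventuallyEq hi).contDiffWithinAt

theorem partialX_add_loss_partialY (T : ℕ) {z : ℝ × ℝ}
    (hz : DifferentiableAt ℝ (L.limitValue T) z) :
    partialX (L.limitValue T) z + L.loss (partialY (L.limitValue T) z) = 0 := by
  obtain ⟨i, hi⟩ := L.exists_eventuallyEq_limitPiece T hz
  rw [hi.partialX_eq, hi.partialY_eq, partialX_limitPiece, partialY_limitPiece, neg_add_cancel]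

theorem mongeAmpere_limitValue (T : ℕ) {z : ℝ × ℝ}
    (hz : DifferentiableAt ℝ (L.limitValue T) z) :
    partialX (partialX (L.limitValue T)) z * partialY (partialY (L.limitValue T)) z -
      partialX (partialY (L.limitValue T)) z ^ 2 = 0 := by
  obtain ⟨i, hi⟩ := L.exists_eventuallyEq_limitPiece T hz
  have hX : partialX (L.limitValue T) =ᶠ[𝓝 z] fun _ => -L.loss (L.price i) := by
    filter_upwards [hi.eventuallyEq_nhds] with z' hz'
    rw [hz'.partialX_eq, partialX_limitPiece]
  have hY : partialY (L.limitValue T) =ᶠ[𝓝 z] fun _ => L.price i := by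
    filter_upwards [hi.eventuallyEq_nhds] with z' hz'
    rw [hz'.partialY_eq, partialY_limitPiece]
  rw [hX.partialX_eq, hY.partialX_eq]
  simp [partialX]

theorem isDistributionalSolution_limitValue (T : ℕ) (U : Set (ℝ × ℝ)) :
    IsDistributionalSolution U L.loss (L.limitValue T) := by
  obtain ⟨C, hC⟩ := L.lipschitzWith_limitValue T
  have hbound : ∀ v z, ‖lineDeriv ℝ (L.limitValue T) z v‖ ≤ C * ‖v‖ := fun v z =>
    norm_lineDeriv_le_of_lipschitz ℝ hC
  have hmeas : ∀ v, Measurable fun z => lineDeriv ℝ (L.limitValue T) z v := fun v =>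
    measurable_lineDeriv hC.continuous
  have hloc : ∀ v, LocallyIntegrable (fun z => lineDeriv ℝ (L.limitValue T) z v) := fun v =>
    (locallyIntegrable_const (C * ‖v‖ : ℝ)).mono (hmeas v).aestronglyMeasurable
      (ae_of_all _ fun z => by
        rw [Real.norm_of_nonneg (by positivity : (0 : ℝ) ≤ C * ‖v‖)]
        exact hbound v z)
  have hae : ∀ᵐ z, L.loss (lineDeriv ℝ (L.limitValue T) z (0, 1)) =
      -lineDeriv ℝ (L.limitValue T) z (1, 0) := by
    filter_upwards [hC.ae_differentiableAt (μ := volume)] with z hz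
    have := L.partialX_add_loss_partialY T hz
    rw [partialX_eq_lineDeriv, partialY_eq_lineDeriv] at this
    linarith
  refine ⟨hC.continuous.locallyIntegrable.locallyIntegrableOn U,
    fun z => lineDeriv ℝ (L.limitValue T) z (0, 1), (hloc _).locallyIntegrableOn U, ?_,
    fun φ hφ => ⟨?_, ?_⟩⟩
  · refine LocallyIntegrable.locallyIntegrableOn ?_ U
    exact (hloc (1, 0)).mono (L.continuous_loss.measurable.comp (hmeas _)).aestronglyMeasurable
      (hae.mono fun z hz => by rw [hz, norm_neg])
  · simp_rw [partialY_eq_lineDeriv]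
    exact hC.integral_mul_lineDeriv_testFunction hφ _
  · simp_rw [partialX_eq_lineDeriv]
    rw [hC.integral_mul_lineDeriv_testFunction hφ, ← integral_neg]
    refine integral_congr_ae (ae_restrict_of_ae (hae.mono fun z hz => ?_))
    simp only
    rw [hz]
    ring

/-- The graph is a cone with vertex over (T, 0), since `fluid` is positively homogeneous. -/
theorem isAlexandrovSolution_limitValue (T : ℕ) :
    IsAlexandrovSolution (Ioo (0 : ℝ) T ×ˢ Ioi (0 : ℝ)) (L.limitValue T) := by
  refine ⟨L.concaveOn_limitValue T ((convex_Ioo _ _).prod (convex_Ioi _)),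
    volume_iUnion_superdifferential_eq_zero (v := ((T : ℝ), 0)) (isOpen_Ioo.prod isOpen_Ioi)
      (fun z hz => hz.1.2) ?_ ?_⟩
  · rintro z ⟨⟨hz0, hzT⟩, hz2 : 0 < z.2⟩ s ⟨hs0, hs1⟩
    have h1 := mul_pos hs0 (sub_pos.2 hzT)
    have h2 := mul_pos hs0 hz2
    refine ⟨⟨?_, ?_⟩, ?_⟩
    · simp only [Prod.fst_add, Prod.smul_fst, Prod.fst_sub, smul_eq_mul]
      nlinarith
    · simp only [Prod.fst_add, Prod.smul_fst, Prod.fst_sub, smul_eq_mul]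
      linarith
    · simpa using h2
  · intro z _ s hs
    rw [limitValue, limitValue, ← L.fluid_smul hs.le]
    simp only [Prod.fst_add, Prod.snd_add, Prod.smul_fst, Prod.smul_snd, smul_eq_mul,
      Prod.fst_sub, Prod.snd_sub]
    congr 1 <;> ring

end RequestLaw

/-! ### Discretisation errors and almost sure convergence for the given requests. -/

namespace RequestLaw

variable {ℓ k : ℕ} (L : RequestLaw ℓ k)

theorem nonempty_size_index (L : RequestLaw ℓ k) : Nonempty (Fin k) := by
  by_contra h
  rw [not_nonempty_iff] at h
  have := L.prob_sum
  simp at this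

open Classical in
/-- The pair of indices of a request with the given price and size. -/
def requestIndex (p : ℝ × ℝ) : Fin (ℓ + 1) × Fin k :=
  if h : ∃ a : Fin (ℓ + 1) × Fin k, (L.price a.1, L.size a.2) = p then h.choose
  else (0, L.nonempty_size_index.some)

theorem requestIndex_apply (a : Fin (ℓ + 1) × Fin k) :
    L.requestIndex (L.price a.1, L.size a.2) = a := by
  have h : ∃ b : Fin (ℓ + 1) × Fin k,
      (L.price b.1, L.size b.2) = (L.price a.1, L.size a.2) := ⟨a, rfl⟩
  rw [requestIndex, dif_pos h]
  have := h.choose_spec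
  rw [Prod.mk.injEq] at this
  exact Prod.ext (L.price_injective this.1) (L.size_injective this.2)

theorem measurable_requestIndex : Measurable L.requestIndex := by
  -- The map differs from a constant only at finitely many points.
  refine Measurable.measurable_of_countable_ne
    (measurable_const (a := ((0 : Fin (ℓ + 1)), L.nonempty_size_index.some))) ?_
  refine (finite_range fun a : Fin (ℓ + 1) × Fin k =>
    (L.price a.1, L.size a.2)).countable.mono fun p hp => ?_
  by_contra h
  have h' : ¬ ∃ a : Fin (ℓ + 1) × Fin k, (L.price a.1, L.size a.2) = p := h
  exact hp (by rw [requestIndex, dif_neg h'])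

/-- Nothing happens in period `0`, so that the policy may be started in period `max t 1`. -/
theorem scaledReward_eq {T : ℕ} (hT : 0 < T) (P Q : ℕ → ℝ) {n : ℕ} (hn : 0 < n) (z : ℝ × ℝ) :
    L.scaledReward T P Q n z = L.reward (n * T) P Q (⌊(n : ℝ) * z.1⌋₊ - 1 + 1)
      (⌊(n : ℝ) * z.2⌋₊ : ℝ) (n * T) / n := by
  have hrun : ∀ N d m, L.run N P Q 0 d (m + 1) = L.run N P Q 1 d m := by
    intro N d m
    induction m with
    | zero => exact run_succ_of_not_accepts L fun h => by simpa using h.1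
    | succ m ih =>
      have h01 : 0 + (m + 1) = 1 + m := by omega
      by_cases h : L.Accepts N (1 + m) (L.run N P Q 1 d m).1 (P (1 + m)) (Q (1 + m))
      · rw [run_succ_of_accepts L h, run_succ_of_accepts L (by rw [ih, h01]; exact h), ih, h01]
      · rw [run_succ_of_not_accepts L h,
          run_succ_of_not_accepts L (by rw [ih, h01]; exact h), ih]
  rw [scaledReward]
  rcases Nat.eq_zero_or_pos ⌊(n : ℝ) * z.1⌋₊ with h | h
  · have hN : n * T + 1 - 0 = n * T - 1 + 1 + 1 - 1 + 1 := by
      have := Nat.mul_pos hn hT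
      omega
    have hN' : n * T - 1 + 1 + 1 - 1 = n * T + 1 - 1 := by
      have := Nat.mul_pos hn hT
      omega
    rw [h, reward, reward, hN, hrun, hN']
  · rw [Nat.sub_add_cancel h]

/-- The scaled optimal value converges to `limitValue`, uniformly, at the rate `n ^ (-1 / 2)`. -/
theorem exists_abs_optimalValue_sub_limitValue_le (T : ℕ) :
    ∃ C : ℝ, ∀ n : ℕ, 0 < n → ∀ z ∈ Icc (0 : ℝ) T ×ˢ Ici (0 : ℝ),
      |L.optimalValue (n * T - (⌊(n : ℝ) * z.1⌋₊ - 1)) ⌊(n : ℝ) * z.2⌋₊ - n * L.limitValue T z| ≤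
        C * √n := by
  have hp := L.topPrice_nonneg
  have hS := L.totalSize_nonneg
  have hl := L.loss_nonneg 0
  refine ⟨L.topPrice + 2 * L.loss 0 + L.topPrice * L.totalSize + L.topPrice ^ 2 +
    (T + 1) * (L.totalSize ^ 2 / 2), ?_⟩
  rintro n hn z ⟨⟨hz0, hzT⟩, hz2 : 0 ≤ z.2⟩
  set t := ⌊(n : ℝ) * z.1⌋₊
  set d := ⌊(n : ℝ) * z.2⌋₊
  set r := n * T - (t - 1) with hr
  have hn0 : (0 : ℝ) < n := by exact_mod_cast hn
  have hn1 : (1 : ℝ) ≤ n := by exact_mod_cast hn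
  have hs1 : 1 ≤ √n := Real.one_le_sqrt.2 hn1
  have ht1 : (t : ℝ) ≤ n * z.1 := Nat.floor_le (by positivity)
  have ht2 : n * z.1 < t + 1 := Nat.lt_floor_add_one _
  have hd1 : (d : ℝ) ≤ n * z.2 := Nat.floor_le (by positivity)
  have hd2 : n * z.2 < d + 1 := Nat.lt_floor_add_one _
  have htT : t ≤ n * T := by
    have : (t : ℝ) ≤ n * T := ht1.trans (mul_le_mul_of_nonneg_left hzT hn0.le)
    exact_mod_cast this
  have hrle : (r : ℝ) ≤ n * T := by exact_mod_cast Nat.sub_le _ _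
  -- Rounding costs at most one period, and starting in period max(t, 1) leaves nT + 1 - max(t, 1)
  -- periods, which costs at most one more.
  have hrT : |(r : ℝ) - n * (T - z.1)| ≤ 2 := by
    rcases Nat.eq_zero_or_pos t with h | h
    · have : (r : ℝ) = n * T := by rw [hr, h]; push_cast; simp
      rw [this]
      rw [h, Nat.cast_zero] at ht2 ht1
      rw [abs_le]
      constructor <;> linarith
    · have : (r : ℝ) = n * T - (t - 1) := by
        rw [hr, Nat.cast_sub (by omega), Nat.cast_sub h]
        push_cast
        ring
      rw [this, abs_le]
      constructor <;> linarith
  have hdd : |(d : ℝ) - n * z.2| ≤ 1 := abs_le.2 ⟨by linarith, by linarith⟩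
  have hlim : n * L.limitValue T z = L.fluid (n * (T - z.1)) (n * z.2) := by
    rw [L.fluid_smul hn0.le, limitValue]
  have hup := L.fluid_le_add r d (n * (T - z.1)) (n * z.2)
  have hlow := L.fluid_le_add (n * (T - z.1)) (n * z.2) r d
  rw [abs_sub_comm _ (d : ℝ), abs_sub_comm _ (r : ℝ)] at hlow
  have e1 := mul_le_mul_of_nonneg_left hdd hp
  have e2 := mul_le_mul_of_nonneg_left hrT hl
  have hJ1 := L.optimalValue_le_fluid r (Nat.cast_nonneg d)
  -- κ = √n balances the terms of order κ and n/κ.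
  have hJ2 := L.fluid_le_optimalValue (zero_lt_one.trans_le hs1) r (Nat.cast_nonneg d)
  have hrs : (r : ℝ) * (L.totalSize ^ 2 / (2 * √n)) ≤ T * (L.totalSize ^ 2 / 2) * √n := by
    refine (mul_le_mul_of_nonneg_right hrle (by positivity)).trans (le_of_eq ?_)
    field_simp
    rw [Real.sq_sqrt hn0.le]
    ring
  have f1 : L.topPrice ≤ L.topPrice * √n := le_mul_of_one_le_right hp hs1
  have f2 : L.loss 0 ≤ L.loss 0 * √n := le_mul_of_one_le_right hl hs1
  have f3 : L.topPrice * L.totalSize ≤ L.topPrice * L.totalSize * √n :=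
    le_mul_of_one_le_right (by positivity) hs1
  have f4 : 0 ≤ L.topPrice ^ 2 * √n := by positivity
  have f5 : 0 ≤ L.totalSize ^ 2 / 2 * √n := by positivity
  have f6 : 0 ≤ T * (L.totalSize ^ 2 / 2) * √n := by positivity
  have f7 : 0 ≤ L.topPrice * L.totalSize * √n := by positivity
  rw [hlim, abs_le]
  constructor <;> linarith

end RequestLaw

namespace IsRequestSequence

variable {Ω : Type*} [MeasurableSpace Ω] {μ : Measure Ω} {ℓ k : ℕ}
  {L : RequestLaw ℓ k} {P Q : ℕ → Ω → ℝ}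

/-- The pair of indices of the request in period `t + 1`. -/
def index (_ : IsRequestSequence L μ P Q) (t : ℕ) (ω : Ω) : Fin (ℓ + 1) × Fin k :=
  L.requestIndex (P (t + 1) ω, Q (t + 1) ω)

theorem measurable_index (h : IsRequestSequence L μ P Q) (t : ℕ) : Measurable (h.index t) :=
  L.measurable_requestIndex.comp
    ((h.measurable_price _ (by omega)).prodMk (h.measurable_size _ (by omega)))

theorem iIndepFun_index (h : IsRequestSequence L μ P Q) : iIndepFun h.index μ :=
  h.indep.comp (fun _ => L.requestIndex) fun _ => L.measurable_requestIndex

variable [IsProbabilityMeasure μ]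

/-- The events of the individual pairs are disjoint with masses summing to 1, so other values have
probability zero. -/
theorem ae_eq_index (h : IsRequestSequence L μ P Q) (t : ℕ) :
    ∀ᵐ ω ∂μ, P (t + 1) ω = L.price (h.index t ω).1 ∧ Q (t + 1) ω = L.size (h.index t ω).2 := by
  set A : Fin (ℓ + 1) × Fin k → Set Ω := fun a =>
    {ω | P (t + 1) ω = L.price a.1 ∧ Q (t + 1) ω = L.size a.2}
  have hmeas : ∀ a, MeasurableSet (A a) := fun a =>
    (h.measurable_price _ (by omega) (measurableSet_singleton _)).inter
      (h.measurable_size _ (by omega) (measurableSet_singleton _))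
  have hdisj : Pairwise (Function.onFun Disjoint A) := by
    intro a b hab
    refine Set.disjoint_left.2 fun ω ha hb => hab ?_
    exact Prod.ext (L.price_injective (ha.1.symm.trans hb.1))
      (L.size_injective (ha.2.symm.trans hb.2))
  have hone : μ (⋃ a, A a) = 1 := by
    rw [measure_iUnion hdisj hmeas, tsum_fintype, Fintype.sum_prod_type]
    have : ∀ i j, μ (A (i, j)) = ENNReal.ofReal (L.prob i j) := fun i j =>
      h.law (t + 1) (by omega) i j
    simp_rw [this]
    rw [← ENNReal.ofReal_one, ← L.prob_sum, ENNReal.ofReal_sum_of_nonneg fun i _ =>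
      Finset.sum_nonneg fun j _ => L.prob_nonneg i j]
    exact Finset.sum_congr rfl fun i _ =>
      (ENNReal.ofReal_sum_of_nonneg fun j _ => L.prob_nonneg i j).symm
  have hae : ∀ᵐ ω ∂μ, ω ∈ ⋃ a, A a := by
    rw [← prob_compl_eq_zero_iff (MeasurableSet.iUnion hmeas)] at hone
    exact hone
  filter_upwards [hae] with ω hω
  obtain ⟨a, h1, h2⟩ := mem_iUnion.1 hω
  have : h.index t ω = a := by rw [index, h1, h2, L.requestIndex_apply]
  rw [this]
  exact ⟨h1, h2⟩

theorem measureReal_index (h : IsRequestSequence L μ P Q) (t : ℕ) (a : Fin (ℓ + 1) × Fin k) :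
    μ.real (h.index t ⁻¹' {a}) = L.prob a.1 a.2 := by
  have hset : h.index t ⁻¹' {a} =ᵐ[μ]
      {ω | P (t + 1) ω = L.price a.1 ∧ Q (t + 1) ω = L.size a.2} := by
    filter_upwards [h.ae_eq_index t] with ω hω
    refine propext ⟨fun (hω' : h.index t ω = a) => hω' ▸ hω, fun hω' => ?_⟩
    change h.index t ω = a
    rw [index, hω'.1, hω'.2, L.requestIndex_apply]
  rw [measureReal_congr hset, measureReal_def, h.law (t + 1) (by omega),
    ENNReal.toReal_ofReal (L.prob_nonneg _ _)]

theorem lossFunction_eq_loss (h : IsRequestSequence L μ P Q) :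
    lossFunction μ (P 1) (Q 1) = L.loss := by
  ext x
  set f : Fin (ℓ + 1) × Fin k → ℝ := fun a => L.size a.2 * max (L.price a.1 - x) 0
  have hae : (fun ω => Q 1 ω * max (P 1 ω - x) 0) =ᵐ[μ] fun ω => f (h.index 0 ω) := by
    filter_upwards [h.ae_eq_index 0] with ω hω
    rw [zero_add] at hω
    simp only [hω, f]
  have : IsFiniteMeasure (μ.map (h.index 0)) := Measure.isFiniteMeasure_map μ _
  rw [lossFunction, integral_congr_ae hae, ← integral_map (f := f) (h.measurable_index 0).aemeasurable
    Measurable.of_discrete.aestronglyMeasurable, integral_fintype Integrable.of_finite,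
    Fintype.sum_prod_type, RequestLaw.loss]
  refine Finset.sum_congr rfl fun i _ => Finset.sum_congr rfl fun j _ => ?_
  rw [map_measureReal_apply (h.measurable_index 0) (measurableSet_singleton _),
    h.measureReal_index, smul_eq_mul]

theorem ae_tendstoUniformlyOn_limitValue (h : IsRequestSequence L μ P Q) {T : ℕ} (hT : 0 < T) :
    ∀ᵐ ω ∂μ, ∀ K : Set (ℝ × ℝ), IsCompact K → K ⊆ Icc (0 : ℝ) T ×ˢ Ici (0 : ℝ) →
      TendstoUniformlyOn
        (fun n => L.scaledReward T (fun t => P t ω) (fun t => Q t ω) n) (L.limitValue T) atTop K := by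
  obtain ⟨C, hC⟩ := L.exists_abs_optimalValue_sub_limitValue_le T
  -- Countably many stock bounds M and tolerances 1/(m + 1) suffice, so a single null set serves all
  -- compact sets.
  have hdev : ∀ᵐ ω ∂μ, ∀ M m : ℕ, ∀ᶠ n : ℕ in atTop, ∀ τ < n * T, ∀ d ≤ n * M,
      |L.reward (n * T) (L.priceSeq fun n => h.index n ω) (L.sizeSeq fun n => h.index n ω) (τ + 1)
        d (n * T) - L.optimalValue (n * T - τ) d| < 1 / ((m : ℝ) + 1) * n :=
    ae_all_iff.2 fun M => ae_all_iff.2 fun m => L.ae_eventually_deviation_lt h.measurable_index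
      h.iIndepFun_index h.measureReal_index T M (by positivity)
  filter_upwards [hdev, ae_all_iff.2 h.ae_eq_index] with ω hω hidx K hK hKsub
  obtain ⟨R, hR⟩ := hK.isBounded.subset_closedBall 0
  rw [Metric.tendstoUniformlyOn_iff]
  intro ε hε
  obtain ⟨m, hm⟩ := exists_nat_one_div_lt (half_pos hε)
  have hsqrt : Tendsto (fun n : ℕ => C * (√n / n)) atTop (𝓝 0) := by
    have h1 : Tendsto (fun n : ℕ => C * (√(n : ℝ))⁻¹) atTop (𝓝 (C * 0)) :=
      ((Real.tendsto_sqrt_atTop.comp tendsto_natCast_atTop_atTop).inv_tendsto_atTop).const_mul C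
    rw [mul_zero] at h1
    refine h1.congr fun n => ?_
    rw [Real.sqrt_div_self]
  filter_upwards [hω ⌈R⌉₊ m, eventually_gt_atTop 0, hsqrt.eventually_lt_const (half_pos hε)]
    with n hn hn0 hnC z hz
  obtain ⟨⟨hz0, hzT⟩, hz2⟩ := hKsub hz
  have hz2 : 0 ≤ z.2 := hz2
  have hn0' : (0 : ℝ) < n := by exact_mod_cast hn0
  have hτ : ⌊(n : ℝ) * z.1⌋₊ - 1 < n * T := by
    have h1 : ⌊(n : ℝ) * z.1⌋₊ ≤ n * T :=
      Nat.floor_le_of_le (by push_cast; exact mul_le_mul_of_nonneg_left hzT hn0'.le)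
    have := Nat.mul_pos hn0 hT
    omega
  have hd : ⌊(n : ℝ) * z.2⌋₊ ≤ n * ⌈R⌉₊ := by
    refine Nat.floor_le_of_le ?_
    push_cast
    refine mul_le_mul_of_nonneg_left (le_trans ?_ (Nat.le_ceil R)) hn0'.le
    have h1 : ‖z‖ ≤ R := by simpa using hR hz
    exact (le_abs_self _).trans ((norm_snd_le z).trans h1)
  have hX := hn _ hτ _ hd
  have hV := hC n hn0 z (hKsub hz)
  have hrun : ∀ N τ d, L.reward N (fun t => P t ω) (fun t => Q t ω) (τ + 1) d N =
      L.reward N (L.priceSeq fun n => h.index n ω) (L.sizeSeq fun n => h.index n ω) (τ + 1) d N := by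
    intro N τ d
    rw [RequestLaw.reward, RequestLaw.reward]
    congr 1
    refine L.run_congr d fun s hs _ => ?_
    have := hidx (s - 1)
    rwa [Nat.sub_add_cancel (by omega)] at this
  rw [L.scaledReward_eq hT _ _ hn0, hrun, dist_comm, Real.dist_eq]
  set X := L.reward (n * T) (L.priceSeq fun n => h.index n ω) (L.sizeSeq fun n => h.index n ω)
    (⌊(n : ℝ) * z.1⌋₊ - 1 + 1) (⌊(n : ℝ) * z.2⌋₊ : ℝ) (n * T)
  have hsplit : X / n - L.limitValue T z = (X - n * L.limitValue T z) / n := by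
    field_simp
  rw [hsplit, abs_div, abs_of_pos hn0', div_lt_iff₀ hn0']
  have hnC' : C * √n < ε / 2 * n := by
    rwa [← mul_div_assoc, div_lt_iff₀ hn0'] at hnC
  have hm' := mul_lt_mul_of_pos_right hm hn0'
  have htri := abs_sub_le X
    (L.optimalValue (n * T - (⌊(n : ℝ) * z.1⌋₊ - 1)) (⌊(n : ℝ) * z.2⌋₊ : ℝ)) (n * L.limitValue T z)
  linarith

end IsRequestSequence

/-- A single period earns at most `topPrice * totalSize`, whatever the stock. -/
theorem RequestLaw.tendsto_value_last_div {ℓ k : ℕ} (L : RequestLaw ℓ k) {T : ℕ} (hT : 0 < T)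
    (y : ℝ) :
    Tendsto (fun n : ℕ => L.value (n * T) (n * T) (⌊(n : ℝ) * y⌋₊ : ℝ) / n) atTop (𝓝 0) := by
  refine squeeze_zero_norm' ?_ (tendsto_const_div_atTop_nhds_zero_nat (L.topPrice * L.totalSize))
  filter_upwards [eventually_gt_atTop 0] with n hn
  have hN : 1 ≤ n * T := Nat.mul_pos hn hT
  have h1 : n * T + 1 - n * T = 1 := by omega
  rw [L.value_eq_optimalValue hN le_rfl, h1, norm_div, Real.norm_natCast,
    Real.norm_of_nonneg (L.optimalValue_nonneg _ _)]
  refine div_le_div_of_nonneg_right ?_ (Nat.cast_nonneg n)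
  rw [optimalValue, ← L.average_const (L.topPrice * L.totalSize)]
  refine L.average_mono fun i j => ?_
  simpa [optimalValue] using L.payoff_le (L.monotone_optimalValue 0) (⌊(n : ℝ) * y⌋₊ : ℝ) i j

end

theorem mainTheorem1 {Ω : Type*} [MeasurableSpace Ω] (μ : Measure Ω) [IsProbabilityMeasure μ]
    {ℓ k : ℕ} (L : RequestLaw ℓ k) (P Q : ℕ → Ω → ℝ) (hPQ : IsRequestSequence L μ P Q)
    (T : ℕ) (hT : 0 < T) (g : ℝ → ℝ) (hg : g = lossFunction μ (P 1) (Q 1))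
    (U : Set (ℝ × ℝ)) (hU : U = Ioo (0 : ℝ) T ×ˢ Ioi (0 : ℝ)) :
    ∃ (u : ℝ × ℝ → ℝ) (h : ℝ → ℝ),
      -- almost sure convergence, uniformly on compact sets
      (∀ᵐ ω ∂μ, ∀ K : Set (ℝ × ℝ), IsCompact K → K ⊆ Icc (0 : ℝ) T ×ˢ Ici (0 : ℝ) →
        TendstoUniformlyOn
          (fun n => L.scaledReward T (fun t => P t ω) (fun t => Q t ω) n) u atTop K) ∧
      -- the limit is Lipschitz up to the boundary
      (∃ C, LipschitzOnWith C u (Icc (0 : ℝ) T ×ˢ Ici (0 : ℝ))) ∧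
      -- the boundary values, where `h` is the scaled value of the last period, namely zero
      (∀ y, 0 ≤ y →
        Tendsto (fun n : ℕ => L.value (n * T) (n * T) (⌊(n : ℝ) * y⌋₊ : ℝ) / n) atTop (𝓝 (h y)) ∧
        h y = 0 ∧ u (T, y) = h y) ∧
      (∀ x ∈ Icc (0 : ℝ) T, u (x, 0) = 0) ∧
      -- `u` is smooth off a closed null set of nondifferentiability, and there the first-order
      -- equation and the homogeneous Monge–Ampère equation hold classically
      IsOpen (differentiabilitySet U u) ∧
      volume (U \ differentiabilitySet U u) = 0 ∧
      ContDiffOn ℝ (⊤ : ℕ∞) u (differentiabilitySet U u) ∧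
      (∀ z ∈ differentiabilitySet U u, partialX u z + g (partialY u z) = 0) ∧
      (∀ z ∈ differentiabilitySet U u,
        partialX (partialX u) z * partialY (partialY u) z - partialX (partialY u) z ^ 2 = 0) ∧
      -- on all of `U` both equations hold in the generalized sense
      IsDistributionalSolution U g u ∧
      IsAlexandrovSolution U u := by
  obtain rfl : g = L.loss := hg.trans hPQ.lossFunction_eq_loss
  subst hU
  have hopen : IsOpen (Ioo (0 : ℝ) T ×ˢ Ioi (0 : ℝ)) := isOpen_Ioo.prod isOpen_Ioi
  obtain ⟨C, hC⟩ := L.lipschitzWith_limitValue T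
  refine ⟨L.limitValue T, fun _ => 0, hPQ.ae_tendstoUniformlyOn_limitValue hT,
    ⟨C, hC.lipschitzOnWith⟩, fun y hy => ⟨L.tendsto_value_last_div hT y, rfl, ?_⟩,
    fun x hx => L.fluid_zero_stock (sub_nonneg.2 hx.2), L.isOpen_differentiabilitySet T hopen, ?_,
    L.contDiffOn_limitValue T _, fun z hz => L.partialX_add_loss_partialY T hz.2,
    fun z hz => L.mongeAmpere_limitValue T hz.2, L.isDistributionalSolution_limitValue T _,
    L.isAlexandrovSolution_limitValue T⟩
  · rw [RequestLaw.limitValue, sub_self]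
    exact L.fluid_zero_time hy
  -- Rademacher's theorem.
  · refine measure_mono_null (fun z hz hd => hz.2 ⟨hz.1, hd⟩)
      (hC.ae_differentiableAt (μ := volume))
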